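/- A plane tree is a finite rooted tree in which the children of every vertex are linearly ordered; its size is its number of vertices. The protection number of a vertex $v$ of a plane tree is the minimal distance from $v$ to a leaf of the maximal subtree rooted at $v$ (so it is $0$ if and only if $v$ is a leaf). For $n\ge 1$ let $Y_n$ be the protection number of a uniformly random vertex of a uniformly random plane tree with $n$ vertices. Then $Y_n$ has a discrete limit law: for every $k\ge 0$, \[ \lim_{n\to\infty}\mathbb P(Y_n=k)=p_k:=\frac{9\cdot 4^k}{(4\cdot 4^k+2)(4^k+2)}, \] where $p_k\ge 0$ and $\sum_{k\ge 0}p_k=1$. More precisely, as $n\to\infty$, uniformly in $k\ge 0$, \[ \mathbb P(Y_n=k)=\frac{9\cdot 4^k}{(4\cdot 4^k+2)(4^k+2)}+\frac{3\cdot 4^k(4^k-1)\bigl((6k-22)4^{3k}+(21k+30)4^{2k}+(21k+96)4^k+(6k+58)\bigr)}{2(4^k+2)^3(2\cdot 4^k+1)^3}\,\frac1n+O\Bigl(\frac{k^2}{3^k n^2}\Bigr). \] Define, by convergent series, \[ d_0=\sum_{k\ge1}\frac{3}{4^k+2},\qquad d_1=\sum_{k\ge1}\frac{(3k-10)4^{2k}+(6k+26)4^k-16}{2(4^k+2)^3},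 \] \[ d_2=\sum_{k\ge1}\frac{3(2k-1)}{4^k+2}-d_0^2,\qquad d_3=\sum_{k\ge1}\frac{(2k-1)\bigl((3k-10)4^{2k}+(6k+26)4^k-16\bigr)}{2(4^k+2)^3}-2d_0d_1. \] Numerically, each with an error of less than one unit in the last given digit, \begin{align*} d_0&\approx 0.727649276913726097531184400482145348863515722775042276537008,\\ d_1&\approx -0.0311837125986222774945246489936100437425899128713521725307175,\\ d_2&\approx 0.81689937948362892278879205623322983539562628691031631640757,\\ d_3&\approx -0.008069306849577412439260970341290668150739539610413792698447. \end{align*} Then, as $n\to\infty$, \[ \mathbb E(Y_n)=d_0+\frac{d_1}{n}+O(n^{-3/2}),\qquad \mathbb V(Y_n)=d_2+\frac{d_3}{n}+O(n^{-3/2}). \] -/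

import Mathlib

open MeasureTheory ProbabilityTheory Filter Topology Asymptotics

/-- Finite rooted plane (ordered) trees: a root together with the finite sequence of the
branches attached to it. -/
inductive PlaneTree : Type
  | node (branches : List PlaneTree) : PlaneTree

namespace PlaneTree

/-- The maximal subtree whose root has address `p`, if there is such a vertex. The root has
address `[]`, and `i :: p` is the vertex with address `p` in the `i`-th branch. -/
def subtreeAt : PlaneTree → List ℕ → Option PlaneTree
  | t, [] => some t
  | node ts, i :: p => ts[i]?.bind fun s => subtreeAt s p

/-- The set of (addresses of) vertices of a plane tree. -/
def vertexSet (t : PlaneTree) : Set (List ℕ) := {p | (t.subtreeAt p).isSome}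

/-- `p` is the address of a leaf, that is, of a vertex without children. -/
def IsLeaf (t : PlaneTree) (p : List ℕ) : Prop := t.subtreeAt p = some (node [])

/-- The protection number of the vertex `p` of `t`: the minimal distance from `p` to a leaf of
the maximal subtree with root `p`. The vertices of that subtree are those with an address
`p ++ q`, and their distance from `p` is the length of `q`. -/
noncomputable def protectionNumber (t : PlaneTree) (p : List ℕ) : ℕ :=
  sInf {d : ℕ | ∃ q : List ℕ, t.IsLeaf (p ++ q) ∧ q.length = d}

/-- The number of vertices. -/
noncomputable def size (t : PlaneTree) : ℕ := t.vertexSet.ncard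

theorem nil_mem_vertexSet (t : PlaneTree) : [] ∈ t.vertexSet := by
  simp [vertexSet, subtreeAt]

theorem cons_mem_vertexSet (ts : List PlaneTree) (i : ℕ) (p : List ℕ) :
    i :: p ∈ (node ts).vertexSet ↔ ∃ s, ts[i]? = some s ∧ p ∈ s.vertexSet := by
  cases h : ts[i]? <;> simp [vertexSet, subtreeAt, h]

theorem finite_vertexSet : ∀ t : PlaneTree, t.vertexSet.Finite
  | node ts => by
    have ih : ∀ i : Fin ts.length, (ts[i]).vertexSet.Finite := fun i => finite_vertexSet ts[i]
    refine ((Set.finite_iUnion fun i : Fin ts.length =>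
      (ih i).image (fun p => i.val :: p)).insert []).subset ?_
    rintro (_ | ⟨i, p⟩) hp
    · exact Set.mem_insert _ _
    · obtain ⟨s, hs, hp⟩ := (cons_mem_vertexSet ts i p).1 hp
      obtain ⟨hi, rfl⟩ := List.getElem?_eq_some_iff.1 hs
      exact Set.mem_insert_of_mem _ (Set.mem_iUnion.2 ⟨⟨i, hi⟩, p, hp, rfl⟩)
termination_by t => sizeOf t
decreasing_by
  have := List.sizeOf_lt_of_mem (List.getElem_mem i.2)
  simp only [node.sizeOf_spec, Fin.getElem_fin]
  omega

theorem length_lt_size (ts : List PlaneTree) : ts.length < (node ts).size := by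
  have h1 : insert [] ((fun i : ℕ => [i]) '' Set.Iio ts.length) ⊆ (node ts).vertexSet := by
    rintro _ (rfl | ⟨i, hi, rfl⟩)
    · exact nil_mem_vertexSet _
    · exact (cons_mem_vertexSet ts i []).2
        ⟨ts[i]'hi, List.getElem?_eq_getElem hi, nil_mem_vertexSet _⟩
  have h2 := Set.ncard_le_ncard h1 (finite_vertexSet _)
  rw [Set.ncard_insert_of_notMem (by simp) ((Set.finite_Iio _).image _),
    Set.ncard_image_of_injective _ (fun a b h => by simpa using h)] at h2
  have h3 : (Set.Iio ts.length).ncard = ts.length := by simp [Set.ncard_eq_toFinset_card']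
  rw [h3] at h2
  exact h2

theorem size_lt_of_mem {ts : List PlaneTree} {s : PlaneTree} (hs : s ∈ ts) :
    s.size < (node ts).size := by
  obtain ⟨i, hi, rfl⟩ := List.getElem_of_mem hs
  have h1 : insert [] ((fun p => i :: p) '' (ts[i]).vertexSet) ⊆ (node ts).vertexSet := by
    rintro _ (rfl | ⟨p, hp, rfl⟩)
    · exact nil_mem_vertexSet _
    · exact (cons_mem_vertexSet ts i p).2 ⟨_, List.getElem?_eq_getElem hi, hp⟩
  have h2 := Set.ncard_le_ncard h1 (finite_vertexSet _)
  rw [Set.ncard_insert_of_notMem (by simp) ((finite_vertexSet _).image _),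
    Set.ncard_image_of_injective _ (fun a b h => by simpa using h)] at h2
  exact h2

theorem finite_size_le (n : ℕ) : {t : PlaneTree | t.size ≤ n}.Finite := by
  induction n with
  | zero =>
    refine Set.finite_empty.subset ?_
    rintro ⟨ts⟩ h
    have := length_lt_size ts
    simp only [Set.mem_ofPred_eq] at h
    omega
  | succ n ih =>
    have := ih.to_subtype
    refine ((List.finite_length_le {t : PlaneTree | t.size ≤ n} n).image
      fun l => node (l.map Subtype.val)).subset ?_
    rintro ⟨ts⟩ h
    simp only [Set.mem_ofPred_eq] at h
    have hts : ∀ s ∈ ts, s ∈ {t : PlaneTree | t.size ≤ n} := fun s hs => by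
      have := size_lt_of_mem hs
      simp only [Set.mem_ofPred_eq]
      omega
    have := length_lt_size ts
    refine ⟨ts.attach.map fun s => ⟨s.1, hts s.1 s.2⟩, ?_, ?_⟩
    · simp only [Set.mem_ofPred_eq, List.length_map, List.length_attach]
      omega
    · simp [Function.comp_def]

theorem exists_size_eq (n : ℕ+) : ∃ t : PlaneTree, t.size = n := by
  induction n using PNat.recOn with
  | one =>
    refine ⟨node [], ?_⟩
    have : (node []).vertexSet = {[]} := by
      ext p
      cases p with
      | nil => simp [nil_mem_vertexSet]
      | cons i p => simp [cons_mem_vertexSet]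
    simp [size, this]
  | succ n ih =>
    obtain ⟨t, ht⟩ := ih
    refine ⟨node [t], ?_⟩
    have : (node [t]).vertexSet = insert [] ((fun p => 0 :: p) '' t.vertexSet) := by
      ext p
      cases p with
      | nil => simp [nil_mem_vertexSet]
      | cons i p => cases i <;> simp [cons_mem_vertexSet]
    rw [size, this, Set.ncard_insert_of_notMem (by simp) ((finite_vertexSet _).image _),
      Set.ncard_image_of_injective _ (fun a b h => by simpa using h)]
    simpa [size] using ht

/-- Plane trees with `n` vertices. -/
abbrev OfSize (n : ℕ+) : Type := {t : PlaneTree // t.size = n}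

instance (n : ℕ+) : Finite (OfSize n) :=
  ((finite_size_le n).subset fun _ h => le_of_eq h).to_subtype

noncomputable instance (n : ℕ+) : Fintype (OfSize n) := Fintype.ofFinite _

instance (n : ℕ+) : Nonempty (OfSize n) := nonempty_subtype.2 (exists_size_eq n)

noncomputable instance (t : PlaneTree) : Fintype t.vertexSet := (finite_vertexSet t).fintype

instance (t : PlaneTree) : Nonempty t.vertexSet := ⟨⟨[], nil_mem_vertexSet t⟩⟩

/-- A plane tree with `n` vertices together with one of its vertices. -/
structure Pointed (n : ℕ+) : Type where
  tree : OfSize n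
  vertex : tree.1.vertexSet

instance (n : ℕ+) : MeasurableSpace (Pointed n) := ⊤

/-- Choose a plane tree with `n` vertices uniformly at random, and then one of its vertices
uniformly at random. -/
noncomputable def randomPointed (n : ℕ+) : PMF (Pointed n) :=
  (PMF.uniformOfFintype (OfSize n)).bind fun t =>
    (PMF.uniformOfFintype t.1.vertexSet).map fun v => ⟨t, v⟩

/-- The probability measure of the random choice of a vertex in a random tree. -/
noncomputable def P (n : ℕ+) : Measure (Pointed n) := (randomPointed n).toMeasure

/-- The random variable `Y n`: the protection number of the chosen vertex. -/
noncomputable def Y (n : ℕ+) (ω : Pointed n) : ℕ := protectionNumber ω.tree.1 ω.vertex.1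

/-- The limit of the probability that `Y n = k`. -/
noncomputable def limitProb (k : ℕ) : ℝ := 9 * 4 ^ k / ((4 * 4 ^ k + 2) * (4 ^ k + 2))

/-- The coefficient of `1 / n` in the expansion of the probability that `Y n = k`. -/
noncomputable def correctionProb (k : ℕ) : ℝ :=
  3 * 4 ^ k * (4 ^ k - 1) *
      ((6 * k - 22) * 4 ^ (3 * k) + (21 * k + 30) * 4 ^ (2 * k) + (21 * k + 96) * 4 ^ k
        + (6 * k + 58)) /
    (2 * (4 ^ k + 2) ^ 3 * (2 * 4 ^ k + 1) ^ 3)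

/-- The summand of the constant `d₀`. -/
noncomputable def a (k : ℕ) : ℝ := 3 / (4 ^ k + 2)

/-- The summand of the constant `d₁`. -/
noncomputable def b (k : ℕ) : ℝ :=
  ((3 * k - 10) * 4 ^ (2 * k) + (6 * k + 26) * 4 ^ k - 16) / (2 * (4 ^ k + 2) ^ 3)

noncomputable def d₀ : ℝ := ∑' k : ℕ+, a k

noncomputable def d₁ : ℝ := ∑' k : ℕ+, b k

noncomputable def d₂ : ℝ := (∑' k : ℕ+, (2 * (k : ℝ) - 1) * a k) - d₀ ^ 2

noncomputable def d₃ : ℝ := (∑' k : ℕ+, (2 * (k : ℝ) - 1) * b k) - 2 * d₀ * d₁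

end PlaneTree

/-!
Let `R_k` enumerate the trees in which every leaf has depth at least `k`. Splitting off the first
branch at the root gives `R_{k+1} (1 - R_k) = X R_k`, which is solved by a rational function of the
tree series `T`. Marking a vertex amounts to multiplying by `S = (1 - 4 X)^{-1/2}`, so the number of
pairs of a tree and a vertex of protection number at least `k` has generating function
`X (A_k S - B_k)`, where `A_k` and `B_k` are rational with weighted `ℓ¹` norm `O(3^{-k})` at radius
`1/3 > 1/4`. Up to `4^j`, the quotient of the central binomial coefficients with indices `m - j` and
`m` is `1 + j / (2 (m + 1)) + O((j + 1)^3 / (m + 1)^2)`. Since `A_k(1/4) = a k` and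
`(X A_k')(1/4) = 2 b k`, this transfers to `ℙ(Y n ≥ k) = a k + b k / n + O(3^{-k} / n ^ 2)`.
Differences in `k` of this expansion give the law, and weighted sums over `k` give the moments.
-/

namespace PlaneTree

/-! ### Protection numbers and the first branch -/

theorem isLeaf_nil_iff (ts : List PlaneTree) : (node ts).IsLeaf [] ↔ ts = [] := by
  simp [IsLeaf, subtreeAt]

theorem isLeaf_cons_iff (ts : List PlaneTree) (i : ℕ) (p : List ℕ) :
    (node ts).IsLeaf (i :: p) ↔ ∃ s, ts[i]? = some s ∧ s.IsLeaf p := by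
  cases h : ts[i]? <;> simp [IsLeaf, subtreeAt, h]

theorem exists_isLeaf : ∀ t : PlaneTree, ∃ p, t.IsLeaf p
  | node [] => ⟨[], (isLeaf_nil_iff _).2 rfl⟩
  | node (s :: ts) => by
    obtain ⟨p, hp⟩ := exists_isLeaf s
    exact ⟨0 :: p, (isLeaf_cons_iff _ _ _).2 ⟨s, rfl, hp⟩⟩

theorem le_protectionNumber_nil_iff (t : PlaneTree) (k : ℕ) :
    k ≤ t.protectionNumber [] ↔ ∀ q, t.IsLeaf q → k ≤ q.length := by
  have hne : {d : ℕ | ∃ q : List ℕ, t.IsLeaf ([] ++ q) ∧ q.length = d}.Nonempty := by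
    obtain ⟨q, hq⟩ := exists_isLeaf t
    exact ⟨_, q, hq, rfl⟩
  rw [protectionNumber, le_csInf_iff (OrderBot.bddBelow _) hne]
  simp

theorem protectionNumber_cons {ts : List PlaneTree} {i : ℕ} {s : PlaneTree}
    (h : ts[i]? = some s) (p : List ℕ) :
    (node ts).protectionNumber (i :: p) = s.protectionNumber p := by
  simp [protectionNumber, isLeaf_cons_iff, h]

theorem protectionNumber_leaf : (node []).protectionNumber [] = 0 := by
  rw [← Nat.le_zero, ← not_lt, ← Nat.succ_le_iff, le_protectionNumber_nil_iff]
  exact fun h => absurd (h [] ((isLeaf_nil_iff _).2 rfl)) (by simp)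

/-- All branches at the root have protection number at least `k`. -/
def BranchesProtected (k : ℕ) : PlaneTree → Prop
  | node ts => ∀ s ∈ ts, k ≤ s.protectionNumber []

theorem branchesProtected_leaf (k : ℕ) : BranchesProtected k (node []) := by
  simp [BranchesProtected]

theorem succ_le_protectionNumber_nil_iff (t : PlaneTree) (k : ℕ) :
    k + 1 ≤ t.protectionNumber [] ↔ t ≠ node [] ∧ BranchesProtected k t := by
  obtain ⟨ts⟩ := t
  simp only [le_protectionNumber_nil_iff, BranchesProtected, ne_eq, node.injEq]
  constructor
  · intro h
    refine ⟨fun h0 => ?_, fun s hs q hq => ?_⟩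
    · simpa using h [] ((isLeaf_nil_iff _).2 h0)
    · obtain ⟨i, hi, rfl⟩ := List.getElem_of_mem hs
      simpa using h (i :: q) ((isLeaf_cons_iff _ _ _).2 ⟨_, List.getElem?_eq_getElem hi, hq⟩)
  · rintro ⟨h0, h⟩ (_ | ⟨i, q⟩) hq
    · exact absurd ((isLeaf_nil_iff _).1 hq) h0
    · obtain ⟨s, hs, hq⟩ := (isLeaf_cons_iff _ _ _).1 hq
      simpa using h s (List.mem_of_getElem? hs) q hq

/-- Attach `s` as the first branch at the root of a tree. Every tree other than the single vertex
is obtained in this way from a unique pair of trees. -/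
def cons (s : PlaneTree) : PlaneTree → PlaneTree
  | node ts => node (s :: ts)

theorem cons_ne_leaf (s t : PlaneTree) : cons s t ≠ node [] := by
  cases t
  simp [cons]

theorem cons_inj {s t s' t' : PlaneTree} : cons s t = cons s' t' ↔ s = s' ∧ t = t' := by
  cases t
  cases t'
  simp [cons]

theorem eq_leaf_or_exists_cons (t : PlaneTree) : t = node [] ∨ ∃ s t', t = cons s t' := by
  obtain ⟨_ | ⟨s, ts⟩⟩ := t
  · exact .inl rfl
  · exact .inr ⟨s, node ts, rfl⟩

theorem branchesProtected_cons (k : ℕ) (s t : PlaneTree) :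
    BranchesProtected k (cons s t) ↔ k ≤ s.protectionNumber [] ∧ BranchesProtected k t := by
  cases t
  simp [BranchesProtected, cons]

theorem succ_le_protectionNumber_cons_iff (k : ℕ) (s t : PlaneTree) :
    k + 1 ≤ (cons s t).protectionNumber [] ↔
      k ≤ s.protectionNumber [] ∧ BranchesProtected k t := by
  rw [succ_le_protectionNumber_nil_iff, branchesProtected_cons, and_iff_right (cons_ne_leaf s t)]

/-- The vertices of protection number at least `k`. -/
def protectedSet (k : ℕ) (t : PlaneTree) : Set (List ℕ) :=
  {p | p ∈ t.vertexSet ∧ k ≤ t.protectionNumber p}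

/-- The number of vertices of protection number at least `k`. -/
noncomputable def countProtected (k : ℕ) (t : PlaneTree) : ℕ := (protectedSet k t).ncard

/-- The number of vertices of protection number at least `k` in the branches at the root. -/
noncomputable def countProtectedBelow (k : ℕ) : PlaneTree → ℕ
  | node ts => (ts.map (countProtected k)).sum

theorem finite_protectedSet (k : ℕ) (t : PlaneTree) : (protectedSet k t).Finite :=
  (finite_vertexSet t).subset fun _ h => h.1

theorem protectedSet_diff_root (k : ℕ) (ts : List PlaneTree) :
    protectedSet k (node ts) \ {[]} =
      ⋃ i : Fin ts.length, (fun p => (i : ℕ) :: p) '' protectedSet k ts[i] := by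
  ext (_ | ⟨i, p⟩)
  · simp
  · have h : i :: p ∈ protectedSet k (node ts) ↔ ∃ s, ts[i]? = some s ∧ p ∈ protectedSet k s := by
      simp only [protectedSet, Set.mem_ofPred_eq, cons_mem_vertexSet, ← exists_and_right,
        and_assoc]
      exact exists_congr fun s => and_congr_right fun hs => by rw [protectionNumber_cons hs]
    simp [h, List.getElem?_eq_some_iff, Fin.exists_iff]

theorem ncard_protectedSet_diff_root (k : ℕ) (t : PlaneTree) :
    (protectedSet k t \ {[]}).ncard = countProtectedBelow k t := by
  obtain ⟨ts⟩ := t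
  rw [protectedSet_diff_root, Set.ncard_iUnion_of_finite
    (fun i => (finite_protectedSet k _).image _), finsum_eq_sum_of_fintype, countProtectedBelow,
    ← Fin.sum_univ_fun_getElem]
  · exact Finset.sum_congr rfl fun i _ => Set.ncard_image_of_injective _ fun _ _ => by simp
  · rintro i j hij
    rw [Function.onFun, Set.disjoint_left]
    rintro _ ⟨p, -, rfl⟩ ⟨q, -, h⟩
    exact hij (Fin.ext (List.cons.inj h).1.symm)

theorem countProtected_eq (k : ℕ) (t : PlaneTree) :
    countProtected k t =
      countProtectedBelow k t + if k ≤ t.protectionNumber [] then 1 else 0 := by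
  rw [← ncard_protectedSet_diff_root, countProtected]
  split_ifs with h
  · exact (Set.ncard_sdiff_singleton_add_one
      (show [] ∈ protectedSet k t from ⟨nil_mem_vertexSet t, h⟩) (finite_protectedSet k t)).symm
  · rw [Set.sdiff_singleton_eq_self fun h' => h h'.2, add_zero]

theorem countProtectedBelow_leaf (k : ℕ) : countProtectedBelow k (node []) = 0 := rfl

theorem countProtectedBelow_cons (k : ℕ) (s t : PlaneTree) :
    countProtectedBelow k (cons s t) = countProtected k s + countProtectedBelow k t := by
  cases t
  simp [countProtectedBelow, cons]

theorem size_eq_countProtected (t : PlaneTree) : t.size = countProtected 0 t := by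
  simp [countProtected, protectedSet, size]

theorem size_pos (t : PlaneTree) : 0 < t.size := by
  simp [size_eq_countProtected, countProtected_eq]

theorem size_leaf : (node []).size = 1 := by
  simp [size_eq_countProtected, countProtected_eq, countProtectedBelow_leaf]

theorem size_cons (s t : PlaneTree) : (cons s t).size = s.size + t.size := by
  simp [size_eq_countProtected, countProtected_eq 0 (cons s t), countProtected_eq 0 t,
    countProtectedBelow_cons, add_assoc]

/-! ### Generating functions -/

open Finset.HasAntidiagonal (antidiagonal)

/-- The plane trees of size `n`. -/
noncomputable def trees (n : ℕ) : Finset PlaneTree :=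
  Set.Finite.toFinset (s := {t | t.size = n}) ((finite_size_le n).subset fun _ h => le_of_eq h)

theorem mem_trees {n : ℕ} {t : PlaneTree} : t ∈ trees n ↔ t.size = n := by
  simp [trees]

theorem leaf_mem_trees_iff {n : ℕ} : node [] ∈ trees n ↔ n = 1 := by
  rw [mem_trees, size_leaf, eq_comm]

open Classical in
theorem sum_trees_erase_leaf {R : Type*} [AddCommMonoid R] (w : PlaneTree → R) (n : ℕ) :
    ∑ t ∈ (trees n).erase (node []), w t =
      ∑ ij ∈ antidiagonal n, ∑ s ∈ trees ij.1, ∑ t ∈ trees ij.2, w (cons s t) := by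
  simp only [← Finset.sum_product', Finset.sum_sigma']
  symm
  refine Finset.sum_nbij (fun x => cons x.2.1 x.2.2) ?_ ?_ ?_ fun _ _ => rfl
  · rintro ⟨ij, s, t⟩ h
    simp_all [mem_trees, cons_ne_leaf, size_cons]
  · rintro ⟨⟨i, j⟩, s, t⟩ h ⟨⟨i', j'⟩, s', t'⟩ h' heq
    obtain ⟨rfl, rfl⟩ := cons_inj.1 heq
    simp only [Finset.coe_sigma, Finset.coe_product, Set.mem_sigma_iff, Set.mem_prod,
      Finset.mem_coe, mem_trees] at h h'
    obtain ⟨-, rfl, rfl⟩ := h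
    obtain ⟨-, rfl, rfl⟩ := h'
    rfl
  · intro t ht
    obtain ⟨hne, ht⟩ := Finset.mem_erase.1 (Finset.mem_coe.1 ht)
    obtain ⟨s, t, rfl⟩ := (eq_leaf_or_exists_cons t).resolve_left hne
    exact ⟨⟨(s.size, t.size), s, t⟩, by simpa [mem_trees, size_cons] using ht, rfl⟩

theorem sum_trees {R : Type*} [AddCommMonoid R] (w : PlaneTree → R) (n : ℕ) :
    ∑ t ∈ trees n, w t = (if n = 1 then w (node []) else 0) +
      ∑ ij ∈ antidiagonal n, ∑ s ∈ trees ij.1, ∑ t ∈ trees ij.2, w (cons s t) := by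
  classical
  rw [← sum_trees_erase_leaf]
  split_ifs with h
  · rw [Finset.add_sum_erase _ _ (leaf_mem_trees_iff.2 h)]
  · rw [Finset.erase_eq_of_notMem (leaf_mem_trees_iff.not.2 h), zero_add]

open PowerSeries

/-- The generating function of the plane trees, weighted by `w`. -/
noncomputable def genFun {R : Type*} [AddCommMonoid R] (w : PlaneTree → R) : R⟦X⟧ :=
  PowerSeries.mk fun n => ∑ t ∈ trees n, w t

theorem genFun_add {R : Type*} [Semiring R] (u v : PlaneTree → R) :
    genFun (fun t => u t + v t) = genFun u + genFun v := by
  ext n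
  simp [genFun, Finset.sum_add_distrib]

theorem genFun_eq_of_cons_eq_mul_add_mul {R : Type*} [Semiring R]
    {w u v u' v' : PlaneTree → R} (h : ∀ s t, w (cons s t) = u s * v t + u' s * v' t) :
    genFun w = C (w (node [])) * X + genFun u * genFun v + genFun u' * genFun v' := by
  ext n
  simp only [genFun, map_add, coeff_C_mul, coeff_X, coeff_mk, mul_ite, mul_one, mul_zero,
    sum_trees w]
  simp [coeff_mul, h, Finset.sum_add_distrib, Finset.sum_mul_sum, add_assoc]

theorem genFun_eq_of_cons_eq_mul {R : Type*} [Semiring R] {w u v : PlaneTree → R}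
    (h : ∀ s t, w (cons s t) = u s * v t) :
    genFun w = C (w (node [])) * X + genFun u * genFun v := by
  have := genFun_eq_of_cons_eq_mul_add_mul (w := w) (u := u) (v := v) (u' := 0) (v' := 0)
    (by simpa using h)
  simpa [show genFun (0 : PlaneTree → R) = 0 by ext; simp [genFun]] using this

/-- The generating function of plane trees. -/
noncomputable def treeSeries : ℝ⟦X⟧ := genFun fun _ => 1

/-- The generating function of the plane trees with the property `p`. -/
noncomputable def countSeries (p : PlaneTree → Prop) [DecidablePred p] : ℝ⟦X⟧ :=
  genFun fun t => if p t then 1 else 0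

/-- The generating function of plane trees whose root has protection number at least `k`. -/
noncomputable def rootSeries (k : ℕ) : ℝ⟦X⟧ := countSeries fun t => k ≤ t.protectionNumber []

open Classical in
/-- The generating function of plane trees all of whose branches have protection number at least
`k`. -/
noncomputable def branchSeries (k : ℕ) : ℝ⟦X⟧ := countSeries (BranchesProtected k)

/-- The generating function of plane trees, weighted by their number of vertices of protection
number at least `k`. -/
noncomputable def vertexSeries (k : ℕ) : ℝ⟦X⟧ := genFun fun t => (countProtected k t : ℝ)

theorem treeSeries_eq : treeSeries = X + treeSeries * treeSeries := by
  simpa [treeSeries] using genFun_eq_of_cons_eq_mul (w := fun _ => (1 : ℝ)) (u := fun _ => 1)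
    (v := fun _ => 1) fun _ _ => (mul_one 1).symm

theorem constantCoeff_treeSeries : constantCoeff treeSeries = 0 := by
  rw [← coeff_zero_eq_constantCoeff_apply, treeSeries, genFun, coeff_mk]
  exact Finset.sum_eq_zero fun t ht => absurd (mem_trees.1 ht) t.size_pos.ne'

theorem countSeries_eq_of_cons_iff {p q r : PlaneTree → Prop} [DecidablePred p] [DecidablePred q]
    [DecidablePred r] (h : ∀ s t, p (cons s t) ↔ q s ∧ r t) :
    countSeries p = (if p (node []) then X else 0) + countSeries q * countSeries r := by
  rw [countSeries, genFun_eq_of_cons_eq_mul (u := fun s => if q s then 1 else 0)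
    (v := fun t => if r t then 1 else 0) fun s t => by simp only [h, ite_and, ite_mul, one_mul,
      zero_mul]]
  split_ifs <;> simp [countSeries]

theorem branchSeries_eq (k : ℕ) : branchSeries k = X + rootSeries k * branchSeries k := by
  classical
  simpa [branchesProtected_leaf, branchSeries, rootSeries] using
    countSeries_eq_of_cons_iff (branchesProtected_cons k)

theorem rootSeries_zero : rootSeries 0 = treeSeries := by
  simp [rootSeries, countSeries, treeSeries]

theorem rootSeries_succ (k : ℕ) : rootSeries (k + 1) = rootSeries k * branchSeries k := by
  classical
  simpa [protectionNumber_leaf, branchSeries, rootSeries] using countSeries_eq_of_cons_iff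
    (p := fun t => k + 1 ≤ t.protectionNumber []) (succ_le_protectionNumber_cons_iff k)

theorem rootSeries_succ_mul (k : ℕ) :
    rootSeries (k + 1) * (1 - rootSeries k) = X * rootSeries k := by
  linear_combination (1 - rootSeries k) * rootSeries_succ k + rootSeries k * branchSeries_eq k

theorem rootSeries_mul (k : ℕ) :
    rootSeries k * (1 - X - treeSeries + X ^ k * treeSeries) = (1 - X) * X ^ k * treeSeries := by
  induction k with
  | zero =>
    rw [rootSeries_zero]
    ring
  | succ k ih =>
    linear_combination (1 - X - treeSeries + X ^ k * treeSeries) * rootSeries_succ_mul k +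
      (X + rootSeries (k + 1)) * ih

theorem vertexSeries_mul (k : ℕ) :
    vertexSeries k * (1 - 2 * treeSeries) = rootSeries k * (1 - treeSeries) := by
  set belowSeries : ℝ⟦X⟧ := genFun fun t => (countProtectedBelow k t : ℝ)
  have h_root : vertexSeries k = belowSeries + rootSeries k := by
    rw [rootSeries, countSeries, ← genFun_add, vertexSeries]
    simp [countProtected_eq]
  have h_below : belowSeries = vertexSeries k * treeSeries + treeSeries * belowSeries := by
    simpa [countProtectedBelow_leaf, vertexSeries, treeSeries, belowSeries] using
      genFun_eq_of_cons_eq_mul_add_mul (w := fun t => (countProtectedBelow k t : ℝ))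
        fun s t => by rw [countProtectedBelow_cons, Nat.cast_add, mul_one, one_mul]
  linear_combination (1 - treeSeries) * h_root + h_below

/-- The generating function of the central binomial coefficients. -/
noncomputable def centralSeries : ℝ⟦X⟧ := PowerSeries.mk fun m => (m.centralBinom : ℝ)

theorem centralSeries_derivative : (1 - 4 * X) * d⁄dX ℝ centralSeries = 2 * centralSeries := by
  rw [show (4 : ℝ⟦X⟧) = C 4 from (map_ofNat C 4).symm,
    show (2 : ℝ⟦X⟧) = C 2 from (map_ofNat C 2).symm]
  ext n
  rw [sub_mul, one_mul, mul_assoc, map_sub, coeff_C_mul, coeff_C_mul]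
  rcases n with _ | n
  · simp [coeff_derivative, centralSeries, Nat.centralBinom]
  · have h : ((n : ℝ) + 1 + 1) * (n + 1 + 1).centralBinom =
        2 * (2 * (n + 1) + 1) * (n + 1).centralBinom := by
      exact_mod_cast Nat.succ_mul_centralBinom_succ (n + 1)
    simp only [coeff_succ_X_mul, coeff_derivative, centralSeries, coeff_mk, Nat.cast_add,
      Nat.cast_one]
    linear_combination h

theorem centralSeries_sq : centralSeries ^ 2 * (1 - 4 * X) = 1 := by
  refine derivative.ext ?_ (by simp [centralSeries])
  have h4 : d⁄dX ℝ (4 : ℝ⟦X⟧) = 0 := by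
    rw [show (4 : ℝ⟦X⟧) = C 4 from (map_ofNat C 4).symm, derivative_C]
  simp only [sq, Derivation.leibniz, map_sub, derivative_one, derivative_X, h4, smul_eq_mul]
  linear_combination 2 * centralSeries * centralSeries_derivative

theorem treeSeries_mul_centralSeries : (1 - 2 * treeSeries) * centralSeries = 1 := by
  have h : ((1 - 2 * treeSeries) * centralSeries) ^ 2 = 1 := by
    linear_combination centralSeries_sq - 4 * centralSeries ^ 2 * treeSeries_eq
  refine (sq_eq_one_iff.1 h).resolve_right fun h_neg => ?_
  have := congrArg constantCoeff h_neg
  norm_num [constantCoeff_treeSeries, centralSeries] at this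

theorem vertexSeries_eq (k : ℕ) :
    vertexSeries k = rootSeries k * (1 - treeSeries) * centralSeries := by
  linear_combination centralSeries * vertexSeries_mul k -
    vertexSeries k * treeSeries_mul_centralSeries

theorem vertexSeries_zero : vertexSeries 0 = X * centralSeries := by
  rw [vertexSeries_eq, rootSeries_zero]
  linear_combination centralSeries * treeSeries_eq

theorem two_mul_vertexSeries_one : 2 * vertexSeries 1 = X * (centralSeries - 1) := by
  have h := rootSeries_succ_mul 0
  rw [rootSeries_zero, zero_add] at h
  rw [vertexSeries_eq]
  linear_combination 2 * centralSeries * h - X * treeSeries_mul_centralSeries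

/-- The norm of the denominator of `rootSeries (k + 2)`, as a rational function of `treeSeries`,
divided by `X ^ 2`. It is the common denominator of the components of `vertexSeries (k + 2)`. -/
noncomputable def denom (k : ℕ) : Polynomial ℝ :=
  1 + .X ^ k - .C 3 * .X ^ (k + 1) + .X ^ (2 * k + 3)

theorem coe_denom (k : ℕ) :
    (denom k : ℝ⟦X⟧) = 1 + X ^ k - 3 * X ^ (k + 1) + X ^ (2 * k + 3) := by
  push_cast [denom]
  rw [map_ofNat]

theorem X_sq_mul_denom (k : ℕ) :
    X ^ 2 * (denom k : ℝ⟦X⟧) = (1 - X - treeSeries + X ^ (k + 2) * treeSeries) *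
      (1 - X - (1 - treeSeries) * (1 - X ^ (k + 2))) := by
  rw [coe_denom]
  linear_combination -(1 - X ^ (k + 2)) ^ 2 * treeSeries_eq

-- Both factors of `X ^ 2 * denom k` are affine in `treeSeries`: the first one cancels the
-- denominator of `rootSeries (k + 2)`, and the second one is its conjugate.
theorem two_mul_vertexSeries_mul_denom (k : ℕ) :
    2 * vertexSeries (k + 2) * (denom k : ℝ⟦X⟧) =
      (1 - X) * X ^ (k + 1) *
        ((1 - 2 * X + X ^ (k + 2)) * centralSeries - (1 - X ^ (k + 2))) := by
  refine mul_left_cancel₀ (pow_ne_zero 2 X_ne_zero) ?_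
  set T := treeSeries
  set S := centralSeries
  have hTT : T * (1 - T) = X := by linear_combination treeSeries_eq
  have hTS : 2 * ((1 - T) * S) = S + 1 := by linear_combination treeSeries_mul_centralSeries
  calc X ^ 2 * (2 * vertexSeries (k + 2) * (denom k : ℝ⟦X⟧))
      = 2 * vertexSeries (k + 2) * (X ^ 2 * (denom k : ℝ⟦X⟧)) := by ring
    _ = 2 * (1 - T) * S * (rootSeries (k + 2) * (1 - X - T + X ^ (k + 2) * T)) *
          (1 - X - (1 - T) * (1 - X ^ (k + 2))) := by rw [X_sq_mul_denom, vertexSeries_eq]; ring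
    _ = 2 * S * (1 - X) * X ^ (k + 2) * (T * (1 - T)) *
          (1 - X - (1 - T) * (1 - X ^ (k + 2))) := by rw [rootSeries_mul]; ring
    _ = (1 - X) * X ^ (k + 3) *
          (2 * S * (1 - X) - 2 * ((1 - T) * S) * (1 - X ^ (k + 2))) := by rw [hTT]; ring
    _ = _ := by rw [hTS]; ring

/-! ### The random vertex -/

theorem hasSum_mul_measureReal_le {Ω : Type*} [MeasurableSpace Ω] (μ : Measure Ω)
    [IsFiniteMeasure μ] {Z : Ω → ℕ} (hZ : Measurable Z) {N : ℕ} (hN : ∀ ω, Z ω ≤ N) (c : ℕ → ℝ) :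
    HasSum (fun k : ℕ+ => c k * μ.real {ω | (k : ℕ) ≤ Z ω})
      (∫ ω, ∑ k ∈ Finset.range (Z ω), c (k + 1) ∂μ) := by
  have hmeas (k : ℕ) : MeasurableSet {ω | k + 1 ≤ Z ω} := hZ measurableSet_Ici
  have hsum (ω : Ω) : ∑ k ∈ Finset.range (Z ω), c (k + 1) =
      ∑ k ∈ Finset.range N, {ω | k + 1 ≤ Z ω}.indicator (fun _ => c (k + 1)) ω := by
    simp only [Set.indicator_apply, Set.mem_ofPred_eq, ← Finset.sum_filter]
    congr 1
    ext k
    simp only [Finset.mem_range, Finset.mem_filter]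
    exact ⟨fun h => ⟨h.trans_le (hN ω), h⟩, And.right⟩
  simp_rw [hsum]
  rw [integral_finsetSum _ fun k _ => (integrable_const _).indicator (hmeas k),
    ← Equiv.pnatEquivNat.symm.hasSum_iff]
  simp_rw [integral_indicator_const _ (hmeas _), smul_eq_mul, mul_comm (μ.real _)]
  refine hasSum_sum_of_ne_finset_zero fun k hk => ?_
  have h_empty : {ω | k < Z ω} = ∅ := Set.eq_empty_of_forall_notMem fun ω hω =>
    hk (Finset.mem_range.2 (lt_of_lt_of_le hω (hN ω)))
  simp [h_empty]

/-- Pointed trees as dependent pairs. -/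
def pointedEquiv (n : ℕ+) : Pointed n ≃ Σ t : OfSize n, t.1.vertexSet where
  toFun ω := ⟨ω.tree, ω.vertex⟩
  invFun p := ⟨p.1, p.2⟩

noncomputable instance (n : ℕ+) : Fintype (Pointed n) := Fintype.ofEquiv _ (pointedEquiv n).symm

instance (n : ℕ+) : Nonempty (Pointed n) :=
  ⟨⟨Classical.arbitrary _, Classical.arbitrary _⟩⟩

instance (n : ℕ+) : DiscreteMeasurableSpace (Pointed n) := ⟨fun _ => trivial⟩

instance (n : ℕ+) : IsProbabilityMeasure (P n) := by
  unfold P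
  infer_instance

theorem card_pointed (n : ℕ+) : Fintype.card (Pointed n) = Fintype.card (OfSize n) * n := by
  have h (t : OfSize n) : t.1.vertexSet.ncard = n := t.2
  simp [Fintype.card_congr (pointedEquiv n), h]

-- All trees of size `n` have the same number of vertices.
theorem randomPointed_eq_uniform (n : ℕ+) :
    randomPointed n = PMF.uniformOfFintype (Pointed n) := by
  classical
  ext ⟨t, v⟩
  rw [randomPointed, PMF.bind_apply, tsum_eq_single t, PMF.map_apply, tsum_eq_single v]
  · have h : t.1.vertexSet.ncard = n := t.2
    simp [PMF.uniformOfFintype_apply, card_pointed, h,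
      ENNReal.mul_inv (.inr (ENNReal.natCast_ne_top n)) (.inl (ENNReal.natCast_ne_top _))]
  · intro v' hv
    simp [hv.symm]
  · intro t' ht
    rw [PMF.map_apply, ENNReal.tsum_eq_zero.2 fun v' => if_neg fun h =>
      ht (congrArg Pointed.tree h).symm, mul_zero]

/-- The probability that the protection number is at least `k`. -/
noncomputable def tailProb (n : ℕ+) (k : ℕ) : ℝ := (P n).real {ω | k ≤ Y n ω}

theorem sum_trees_eq_sum_ofSize {R : Type*} [AddCommMonoid R] (n : ℕ+) (w : PlaneTree → R) :
    ∑ t ∈ trees n, w t = ∑ t : OfSize n, w t.1 :=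
  Finset.sum_subtype (trees n) (fun _ => mem_trees) w

theorem coeff_vertexSeries (n : ℕ+) (k : ℕ) :
    coeff n (vertexSeries k) = Nat.card {ω : Pointed n // k ≤ Y n ω} := by
  let e : {ω : Pointed n // k ≤ Y n ω} ≃ Σ t : OfSize n, protectedSet k t.1 :=
    { toFun ω := ⟨ω.1.tree, ω.1.vertex, ω.1.vertex.2, ω.2⟩
      invFun p := ⟨⟨p.1, p.2, p.2.2.1⟩, p.2.2.2⟩ }
  have (t : OfSize n) : Finite (protectedSet k t.1) := (finite_protectedSet k t.1).to_subtype
  rw [vertexSeries, genFun, coeff_mk, sum_trees_eq_sum_ofSize, Nat.card_congr e, Nat.card_sigma,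
    Nat.cast_sum]
  rfl

theorem tailProb_eq_div (n : ℕ+) (k : ℕ) :
    tailProb n k = coeff n (vertexSeries k) / coeff n (vertexSeries 0) := by
  classical
  rw [tailProb, P, randomPointed_eq_uniform, measureReal_def,
    PMF.toMeasure_uniformOfFintype_apply _ .of_discrete, coeff_vertexSeries, coeff_vertexSeries,
    ENNReal.toReal_div]
  simp [Fintype.card_subtype]

theorem tailProb_eq (n : ℕ+) (k : ℕ) :
    tailProb n k = coeff n (vertexSeries k) / ((n : ℕ) - 1).centralBinom := by
  obtain ⟨m, hm⟩ := Nat.exists_eq_succ_of_ne_zero n.ne_zero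
  rw [tailProb_eq_div, vertexSeries_zero, hm, coeff_succ_X_mul]
  simp [centralSeries]

theorem prob_eq_sub_tailProb (n : ℕ+) (k : ℕ) :
    (P n).real {ω | Y n ω = k} = tailProb n k - tailProb n (k + 1) := by
  have h : {ω | Y n ω = k} = {ω | k ≤ Y n ω} \ {ω | k + 1 ≤ Y n ω} := by
    ext ω
    simp only [Set.mem_ofPred_eq, Set.mem_sdiff]
    lia
  have h_sub : {ω | k + 1 ≤ Y n ω} ⊆ {ω | k ≤ Y n ω} := fun _ => Nat.le_of_succ_le
  rw [h, measureReal_sdiff h_sub .of_discrete, tailProb, tailProb]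

theorem hasSum_mul_tailProb (n : ℕ+) (c : ℕ → ℝ) :
    HasSum (fun k : ℕ+ => c k * tailProb n k)
      (∫ ω, ∑ k ∈ Finset.range (Y n ω), c (k + 1) ∂(P n)) := by
  obtain ⟨N, hN⟩ := (Set.finite_range (Y n)).bddAbove
  exact hasSum_mul_measureReal_le (P n) .of_discrete (fun ω => hN ⟨ω, rfl⟩) c

theorem hasSum_tailProb (n : ℕ+) :
    HasSum (fun k : ℕ+ => tailProb n k) (∫ ω, (Y n ω : ℝ) ∂(P n)) := by
  simpa using hasSum_mul_tailProb n fun _ => 1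

theorem sum_range_two_mul_add_one (N : ℕ) :
    ∑ k ∈ Finset.range N, (2 * ((k + 1 : ℕ) : ℝ) - 1) = (N : ℝ) ^ 2 := by
  induction N with
  | zero => simp
  | succ N ih =>
    rw [Finset.sum_range_succ, ih]
    push_cast
    ring

theorem hasSum_two_mul_sub_one_mul_tailProb (n : ℕ+) :
    HasSum (fun k : ℕ+ => (2 * (k : ℝ) - 1) * tailProb n k) (∫ ω, (Y n ω : ℝ) ^ 2 ∂(P n)) := by
  simpa only [sum_range_two_mul_add_one] using hasSum_mul_tailProb n fun k => 2 * (k : ℝ) - 1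

theorem variance_Y (n : ℕ+) :
    variance (fun ω => (Y n ω : ℝ)) (P n) =
      (∫ ω, (Y n ω : ℝ) ^ 2 ∂(P n)) - (∫ ω, (Y n ω : ℝ) ∂(P n)) ^ 2 :=
  variance_eq_sub MemLp.of_discrete

/-! ### Weighted bounds for power series -/

section WeightedBound

variable {𝕜 : Type*} [NormedField 𝕜]

/-- The power series `A` has weighted `ℓ¹` norm at most `c`, where the `j`-th coefficient has
weight `ρ ^ j`. -/
def WeightedBound (ρ : ℝ) (A : 𝕜⟦X⟧) (c : ℝ) : Prop :=
  ∀ N, ∑ j ∈ Finset.range N, ‖coeff j A‖ * ρ ^ j ≤ c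

theorem sum_range_norm_coeff_add_le {ρ : ℝ} (hρ : 0 ≤ ρ) (A B : 𝕜⟦X⟧) (N : ℕ) :
    ∑ j ∈ Finset.range N, ‖coeff j (A + B)‖ * ρ ^ j ≤
      ∑ j ∈ Finset.range N, ‖coeff j A‖ * ρ ^ j + ∑ j ∈ Finset.range N, ‖coeff j B‖ * ρ ^ j := by
  rw [← Finset.sum_add_distrib]
  refine Finset.sum_le_sum fun j _ => ?_
  rw [map_add, ← add_mul]
  exact mul_le_mul_of_nonneg_right (norm_add_le _ _) (by positivity)

theorem sum_range_norm_coeff_mul_le {ρ : ℝ} (hρ : 0 ≤ ρ) (A B : 𝕜⟦X⟧) (N : ℕ) :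
    ∑ n ∈ Finset.range N, ‖coeff n (A * B)‖ * ρ ^ n ≤
      (∑ i ∈ Finset.range N, ‖coeff i A‖ * ρ ^ i) * ∑ j ∈ Finset.range N, ‖coeff j B‖ * ρ ^ j := by
  set f : ℕ × ℕ → ℝ := fun p => ‖coeff p.1 A‖ * ρ ^ p.1 * (‖coeff p.2 B‖ * ρ ^ p.2)
  have hf (p : ℕ × ℕ) : 0 ≤ f p := by positivity
  calc ∑ n ∈ Finset.range N, ‖coeff n (A * B)‖ * ρ ^ n
      ≤ ∑ n ∈ Finset.range N, ∑ p ∈ antidiagonal n, f p := by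
        refine Finset.sum_le_sum fun n _ => ?_
        rw [coeff_mul]
        refine (mul_le_mul_of_nonneg_right (norm_sum_le _ _) (by positivity)).trans_eq ?_
        rw [Finset.sum_mul]
        refine Finset.sum_congr rfl fun p hp => ?_
        rw [← Finset.HasAntidiagonal.mem_antidiagonal.1 hp, norm_mul, pow_add]
        ring
    _ ≤ ∑ n ∈ Finset.range N, ∑ p ∈ Finset.range N ×ˢ Finset.range N with p.1 + p.2 = n, f p := by
        refine Finset.sum_le_sum fun n hn => Finset.sum_le_sum_of_subset_of_nonneg ?_
          fun p _ _ => hf p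
        intro p hp
        simp only [Finset.HasAntidiagonal.mem_antidiagonal, Finset.mem_filter, Finset.mem_product,
          Finset.mem_range] at hp hn ⊢
        lia
    _ ≤ ∑ p ∈ Finset.range N ×ˢ Finset.range N, f p :=
        Finset.sum_fiberwise_le_sum_of_sum_fiber_nonneg fun _ _ =>
          Finset.sum_nonneg fun p _ => hf p
    _ = _ := by rw [Finset.sum_mul_sum, Finset.sum_product]

theorem weightedBound_C_mul_X_pow {ρ : ℝ} (hρ : 0 ≤ ρ) (a : 𝕜) (k : ℕ) :
    WeightedBound ρ (C a * X ^ k) (‖a‖ * ρ ^ k) := by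
  intro N
  have h (j : ℕ) : ‖coeff j (C a * X ^ k)‖ * ρ ^ j = if j = k then ‖a‖ * ρ ^ k else 0 := by
    rw [coeff_C_mul, coeff_X_pow]
    split_ifs with h <;> simp [h]
  rw [Finset.sum_congr rfl fun j _ => h j, Finset.sum_ite_eq']
  split_ifs
  · rfl
  · positivity

theorem weightedBound_X_pow {ρ : ℝ} (hρ : 0 ≤ ρ) (k : ℕ) :
    WeightedBound ρ (X ^ k : 𝕜⟦X⟧) (ρ ^ k) := by
  simpa using weightedBound_C_mul_X_pow hρ (1 : 𝕜) k

theorem weightedBound_X {ρ : ℝ} (hρ : 0 ≤ ρ) : WeightedBound ρ (X : 𝕜⟦X⟧) ρ := by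
  simpa using weightedBound_X_pow (𝕜 := 𝕜) hρ 1

theorem weightedBound_one {ρ : ℝ} (hρ : 0 ≤ ρ) : WeightedBound ρ (1 : 𝕜⟦X⟧) 1 := by
  simpa using weightedBound_X_pow (𝕜 := 𝕜) hρ 0

namespace WeightedBound

variable {ρ c d : ℝ} {A B : 𝕜⟦X⟧}

theorem nonneg (hA : WeightedBound ρ A c) : 0 ≤ c := by
  simpa using hA 0

theorem mono (hA : WeightedBound ρ A c) (h : c ≤ d) : WeightedBound ρ A d :=
  fun N => (hA N).trans h

theorem neg (hA : WeightedBound ρ A c) : WeightedBound ρ (-A) c := by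
  simpa [WeightedBound] using hA

theorem add (hρ : 0 ≤ ρ) (hA : WeightedBound ρ A c) (hB : WeightedBound ρ B d) :
    WeightedBound ρ (A + B) (c + d) := fun N =>
  (sum_range_norm_coeff_add_le hρ A B N).trans (add_le_add (hA N) (hB N))

theorem sub (hρ : 0 ≤ ρ) (hA : WeightedBound ρ A c) (hB : WeightedBound ρ B d) :
    WeightedBound ρ (A - B) (c + d) := by
  rw [sub_eq_add_neg]
  exact hA.add hρ hB.neg

theorem mul (hρ : 0 ≤ ρ) (hA : WeightedBound ρ A c) (hB : WeightedBound ρ B d) :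
    WeightedBound ρ (A * B) (c * d) := fun N =>
  (sum_range_norm_coeff_mul_le hρ A B N).trans <|
    mul_le_mul (hA N) (hB N) (Finset.sum_nonneg fun _ _ => by positivity) hA.nonneg

-- The constant term `u` dominates: `u A = 1 + B A` bounds each partial sum of the weighted norm of
-- `A` in terms of itself.
theorem of_C_sub_mul_eq_one (hρ : 0 ≤ ρ) {u : 𝕜} (hB : WeightedBound ρ B d) (hd : d < ‖u‖)
    (h : (C u - B) * A = 1) : WeightedBound ρ A (‖u‖ - d)⁻¹ := by
  intro N
  have hu : 0 < ‖u‖ - d := sub_pos.2 hd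
  have hA : C u * A = 1 + B * A := by linear_combination h
  set s := ∑ j ∈ Finset.range N, ‖coeff j A‖ * ρ ^ j
  have hs : 0 ≤ s := Finset.sum_nonneg fun _ _ => by positivity
  have h_le : ‖u‖ * s ≤ 1 + d * s :=
    calc ‖u‖ * s = ∑ j ∈ Finset.range N, ‖coeff j (1 + B * A)‖ * ρ ^ j := by
          simp only [← hA, coeff_C_mul, norm_mul, s, Finset.mul_sum, mul_assoc]
      _ ≤ 1 + d * s := (sum_range_norm_coeff_add_le hρ 1 (B * A) N).trans <|
          add_le_add (weightedBound_one hρ N) ((sum_range_norm_coeff_mul_le hρ B A N).trans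
            (mul_le_mul_of_nonneg_right (hB N) hs))
  rw [← one_div, le_div_iff₀ hu]
  linarith

theorem summable (hρ : 0 ≤ ρ) (hA : WeightedBound ρ A c) :
    Summable fun j => ‖coeff j A‖ * ρ ^ j :=
  summable_of_sum_range_le (fun _ => by positivity) hA

theorem tsum_le (hρ : 0 ≤ ρ) (hA : WeightedBound ρ A c) : ∑' j, ‖coeff j A‖ * ρ ^ j ≤ c :=
  Real.tsum_le_of_sum_range_le (fun _ => by positivity) hA

theorem norm_coeff_le (hρ : 0 ≤ ρ) (hA : WeightedBound ρ A c) (j : ℕ) :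
    ‖coeff j A‖ * ρ ^ j ≤ c :=
  (hA.summable hρ).le_tsum j (fun _ _ => by positivity) |>.trans (hA.tsum_le hρ)

end WeightedBound

end WeightedBound

/-! ### Evaluation inside the disc of convergence -/

section Evaluation

variable {𝕜 : Type*} [NormedField 𝕜]

/-- The value of the power series `A` at the point `x`; it is meaningful if the series converges
at `x`, and `0` by convention if it does not. -/
noncomputable def evalAt (x : 𝕜) (A : 𝕜⟦X⟧) : 𝕜 := ∑' j, coeff j A * x ^ j

theorem evalAt_coe (x : 𝕜) (p : Polynomial 𝕜) : evalAt x (p : 𝕜⟦X⟧) = p.eval x := by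
  rw [evalAt, Polynomial.eval_eq_sum, Polynomial.sum]
  simp only [Polynomial.coeff_coe]
  exact tsum_eq_sum fun j hj => by rw [Polynomial.notMem_support_iff.1 hj, zero_mul]

theorem evalAt_mul [CompleteSpace 𝕜] {x : 𝕜} {A B : 𝕜⟦X⟧}
    (hA : Summable fun j => ‖coeff j A * x ^ j‖) (hB : Summable fun j => ‖coeff j B * x ^ j‖) :
    evalAt x (A * B) = evalAt x A * evalAt x B := by
  rw [evalAt, evalAt, evalAt, tsum_mul_tsum_eq_tsum_sum_antidiagonal_of_summable_norm hA hB]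
  refine tsum_congr fun n => ?_
  rw [coeff_mul, Finset.sum_mul]
  refine Finset.sum_congr rfl fun p hp => ?_
  rw [← Finset.HasAntidiagonal.mem_antidiagonal.1 hp, pow_add]
  ring

theorem summable_norm_coeff_coe_mul_pow (x : 𝕜) (p : Polynomial 𝕜) :
    Summable fun j => ‖coeff j (p : 𝕜⟦X⟧) * x ^ j‖ :=
  summable_of_ne_finset_zero (s := p.support) fun j hj => by
    rw [Polynomial.coeff_coe, Polynomial.notMem_support_iff.1 hj, zero_mul, norm_zero]

theorem coeff_X_mul_derivative {R : Type*} [CommSemiring R] (A : R⟦X⟧) (j : ℕ) :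
    coeff j (X * d⁄dX R A) = j * coeff j A := by
  cases j with
  | zero => simp
  | succ j =>
    rw [coeff_succ_X_mul, coeff_derivative, Nat.cast_succ, mul_comm]

namespace WeightedBound

variable {ρ c : ℝ} {A : 𝕜⟦X⟧} {x : 𝕜}

theorem summable_norm_coeff_mul_pow (hA : WeightedBound ρ A c) (hx : ‖x‖ ≤ ρ) :
    Summable fun j => ‖coeff j A * x ^ j‖ := by
  refine .of_nonneg_of_le (fun j => norm_nonneg _) (fun j => ?_)
    (hA.summable ((norm_nonneg x).trans hx))
  rw [norm_mul, norm_pow]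
  gcongr

theorem summable_norm_coeff_X_mul_derivative_mul_pow (hA : WeightedBound ρ A c) (hx : ‖x‖ < ρ) :
    Summable fun j => ‖coeff j (X * d⁄dX 𝕜 A) * x ^ j‖ := by
  have hρ : 0 < ρ := (norm_nonneg x).trans_lt hx
  have hr : ‖‖x‖ / ρ‖ < 1 := by
    rwa [Real.norm_of_nonneg (by positivity), div_lt_one hρ]
  refine .of_nonneg_of_le (fun j => norm_nonneg _) (fun j => ?_)
    ((summable_pow_mul_geometric_of_norm_lt_one 1 hr).mul_left c)
  calc ‖coeff j (X * d⁄dX 𝕜 A) * x ^ j‖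
      ≤ j * ‖coeff j A‖ * ‖x‖ ^ j := by
        rw [coeff_X_mul_derivative, norm_mul, norm_mul, norm_pow]
        gcongr
        simpa using Nat.norm_cast_le (α := 𝕜) j
    _ = ‖coeff j A‖ * ρ ^ j * (j ^ 1 * (‖x‖ / ρ) ^ j) := by
        rw [div_pow]
        field_simp
    _ ≤ c * (j ^ 1 * (‖x‖ / ρ) ^ j) := by
        gcongr
        exact hA.norm_coeff_le hρ.le j

variable [CompleteSpace 𝕜] {p q : Polynomial 𝕜}

theorem evalAt_mul_eval_eq (hA : WeightedBound ρ A c) (hx : ‖x‖ ≤ ρ)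
    (h : A * (p : 𝕜⟦X⟧) = q) : evalAt x A * p.eval x = q.eval x := by
  rw [← evalAt_coe x p, ← evalAt_coe x q, ← h,
    evalAt_mul (hA.summable_norm_coeff_mul_pow hx) (summable_norm_coeff_coe_mul_pow x p)]

theorem evalAt_X_mul_derivative_mul_eval_sq_eq (hA : WeightedBound ρ A c) (hx : ‖x‖ < ρ)
    (h : A * (p : 𝕜⟦X⟧) = q) :
    evalAt x (X * d⁄dX 𝕜 A) * p.eval x ^ 2 =
      x * (p.eval x * q.derivative.eval x - p.derivative.eval x * q.eval x) := by
  have h_quotient : X * d⁄dX 𝕜 A * ((p ^ 2 : Polynomial 𝕜) : 𝕜⟦X⟧) =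
      ((.X * (p * q.derivative - p.derivative * q) : Polynomial 𝕜) : 𝕜⟦X⟧) := by
    have h_deriv := congrArg (d⁄dX 𝕜) h
    rw [Derivation.leibniz, derivative_coe, derivative_coe, smul_eq_mul, smul_eq_mul] at h_deriv
    push_cast
    linear_combination X * (p : 𝕜⟦X⟧) * h_deriv - X * (p.derivative : 𝕜⟦X⟧) * h
  have h_eval := congrArg (evalAt x) h_quotient
  rw [evalAt_mul (hA.summable_norm_coeff_X_mul_derivative_mul_pow hx)
    (summable_norm_coeff_coe_mul_pow x _), evalAt_coe, evalAt_coe] at h_eval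
  simpa using h_eval

end WeightedBound

end Evaluation

/-! ### The singular and the regular part -/

/-- The numerator of `singularPart`. -/
noncomputable def singularNum (k : ℕ) : Polynomial ℝ :=
  .C (1 / 2) * (1 - .X) * .X ^ k * (1 - .C 2 * .X + .X ^ (k + 2))

/-- The numerator of `regularPart`. -/
noncomputable def regularNum (k : ℕ) : Polynomial ℝ :=
  .C (1 / 2) * (1 - .X) * .X ^ k * (1 - .X ^ (k + 2))

/-- The rational factor of `(1 - 4 X) ^ (-1 / 2)` in `vertexSeries (k + 2) / X`. -/
noncomputable def singularPart (k : ℕ) : ℝ⟦X⟧ := singularNum k * (denom k : ℝ⟦X⟧)⁻¹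

/-- The rational part of `vertexSeries (k + 2) / X`, up to sign. -/
noncomputable def regularPart (k : ℕ) : ℝ⟦X⟧ := regularNum k * (denom k : ℝ⟦X⟧)⁻¹

theorem inv_denom_mul_denom (k : ℕ) : (denom k : ℝ⟦X⟧)⁻¹ * denom k = 1 := by
  refine PowerSeries.inv_mul_cancel _ ?_
  rw [Polynomial.constantCoeff_coe, denom]
  cases k <;> simp [Polynomial.coeff_zero_eq_eval_zero]

theorem singularPart_mul_denom (k : ℕ) : singularPart k * denom k = singularNum k := by
  rw [singularPart, mul_assoc, inv_denom_mul_denom, mul_one]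

theorem regularPart_mul_denom (k : ℕ) : regularPart k * denom k = regularNum k := by
  rw [regularPart, mul_assoc, inv_denom_mul_denom, mul_one]

theorem vertexSeries_add_two (k : ℕ) :
    vertexSeries (k + 2) = X * (singularPart k * centralSeries - regularPart k) := by
  have h_vertex := two_mul_vertexSeries_mul_denom k
  have h_half : (C (1 / 2) : ℝ⟦X⟧) * 2 = 1 := by
    rw [← map_ofNat (C : ℝ →+* ℝ⟦X⟧), ← map_mul]
    norm_num
  have h_two : (C 2 : ℝ⟦X⟧) = 2 := map_ofNat _ 2
  refine mul_right_cancel₀ (right_ne_zero_of_mul_eq_one (inv_denom_mul_denom k)) ?_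
  calc vertexSeries (k + 2) * (denom k : ℝ⟦X⟧)
      = X * ((singularNum k : ℝ⟦X⟧) * centralSeries - (regularNum k : ℝ⟦X⟧)) := by
        rw [singularNum, regularNum]
        push_cast
        rw [h_two]
        linear_combination C (1 / 2) * h_vertex -
          vertexSeries (k + 2) * (denom k : ℝ⟦X⟧) * h_half
    _ = X * (singularPart k * centralSeries - regularPart k) * (denom k : ℝ⟦X⟧) := by
        rw [← singularPart_mul_denom, ← regularPart_mul_denom]
        ring

theorem weightedBound_inv_denom (k : ℕ) : WeightedBound (1 / 3) (denom k : ℝ⟦X⟧)⁻¹ 4 := by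
  have hρ : (0 : ℝ) ≤ 1 / 3 := by norm_num
  have hX (k : ℕ) := weightedBound_X_pow (𝕜 := ℝ) hρ k
  have h3X (k : ℕ) := weightedBound_C_mul_X_pow hρ (3 : ℝ) k
  have h_inv := inv_denom_mul_denom k
  rw [mul_comm] at h_inv
  cases k with
  | zero =>
    refine (((h3X 1).sub hρ (hX 3)).of_C_sub_mul_eq_one (u := 2) hρ (by norm_num) ?_).mono
      (by norm_num)
    rw [← h_inv, coe_denom, map_ofNat, map_ofNat]
    ring
  | succ k =>
    have h_le : (1 / 3 : ℝ) ^ k ≤ 1 := pow_le_one₀ hρ (by norm_num)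
    have h_nonneg : 0 ≤ (1 / 3 : ℝ) ^ k := by positivity
    have h_sq_le : ((1 / 3 : ℝ) ^ k) ^ 2 ≤ 1 := pow_le_one₀ h_nonneg h_le
    have h_sum : ‖(3 : ℝ)‖ * (1 / 3) ^ (k + 2) + (1 / 3) ^ (k + 1) + (1 / 3) ^ (2 * k + 5) ≤
        3 / 4 := by
      rw [Real.norm_ofNat]
      ring_nf at h_le h_sq_le ⊢
      linarith
    refine ((((h3X (k + 2)).sub hρ (hX (k + 1))).sub hρ (hX (2 * k + 5))).of_C_sub_mul_eq_one
      (u := 1) hρ (h_sum.trans_lt (by norm_num)) ?_).mono ?_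
    · rw [← h_inv, coe_denom, map_ofNat, map_one]
      ring
    · rw [norm_one]
      exact inv_le_of_inv_le₀ (by norm_num) (by linarith)

theorem weightedBound_mul_inv_denom {B : ℝ⟦X⟧} (hB : WeightedBound (1 / 3) B 3) (k : ℕ) :
    WeightedBound (1 / 3) (C (1 / 2) * (1 - X) * X ^ k * B * (denom k : ℝ⟦X⟧)⁻¹)
      (8 * (1 / 3) ^ k) := by
  have hρ : (0 : ℝ) ≤ 1 / 3 := by norm_num
  have h_half : WeightedBound (1 / 3) (C (1 / 2) : ℝ⟦X⟧) (1 / 2) := by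
    simpa [abs_of_pos] using weightedBound_C_mul_X_pow hρ (1 / 2 : ℝ) 0
  have h_one_sub := (weightedBound_one (𝕜 := ℝ) hρ).sub hρ (weightedBound_X hρ)
  refine (((((h_half.mul hρ h_one_sub).mul hρ (weightedBound_X_pow hρ k)).mul hρ hB).mul hρ
    (weightedBound_inv_denom k)).mono (le_of_eq ?_))
  ring

theorem weightedBound_singularPart (k : ℕ) :
    WeightedBound (1 / 3) (singularPart k) (8 * (1 / 3) ^ k) := by
  have hρ : (0 : ℝ) ≤ 1 / 3 := by norm_num
  have h_two : WeightedBound (1 / 3) (C 2 * X : ℝ⟦X⟧) (2 * (1 / 3)) := by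
    simpa using weightedBound_C_mul_X_pow hρ (2 : ℝ) 1
  have h_le : (1 / 3 : ℝ) ^ (k + 2) ≤ 1 := pow_le_one₀ hρ (by norm_num)
  rw [singularPart, singularNum]
  push_cast
  exact weightedBound_mul_inv_denom ((((weightedBound_one hρ).sub hρ h_two).add hρ
    (weightedBound_X_pow hρ _)).mono (by linarith)) k

theorem weightedBound_regularPart (k : ℕ) :
    WeightedBound (1 / 3) (regularPart k) (8 * (1 / 3) ^ k) := by
  have hρ : (0 : ℝ) ≤ 1 / 3 := by norm_num
  have h_le : (1 / 3 : ℝ) ^ (k + 2) ≤ 1 := pow_le_one₀ hρ (by norm_num)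
  rw [regularPart, regularNum]
  push_cast
  exact weightedBound_mul_inv_denom (((weightedBound_one hρ).sub hρ
    (weightedBound_X_pow hρ _)).mono (by linarith)) k

theorem evalAt_singularPart (k : ℕ) : evalAt (1 / 4) (singularPart k) = a (k + 2) := by
  have h := (weightedBound_singularPart k).evalAt_mul_eval_eq (x := 1 / 4)
    (by norm_num [abs_of_pos]) (singularPart_mul_denom k)
  have h_pow (m : ℕ) : (1 / 4 : ℝ) ^ m = ((4 : ℝ) ^ m)⁻¹ := by rw [one_div, inv_pow]
  simp only [denom, singularNum, Polynomial.eval_add, Polynomial.eval_sub, Polynomial.eval_mul,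
    Polynomial.eval_pow, Polynomial.eval_X, Polynomial.eval_one, Polynomial.eval_C, h_pow, pow_add,
    pow_mul'] at h
  have hx : (0 : ℝ) < 4 ^ k := by positivity
  rw [a, pow_add, eq_div_iff (by positivity)]
  generalize (4 : ℝ) ^ k = x at *
  field_simp at h
  refine mul_left_cancel₀ (by positivity : x + 1 / 8 ≠ 0) ?_
  linear_combination h / 8

theorem evalAt_X_mul_derivative_singularPart (k : ℕ) :
    evalAt (1 / 4) (X * d⁄dX ℝ (singularPart k)) = 2 * b (k + 2) := by
  have h := (weightedBound_singularPart k).evalAt_X_mul_derivative_mul_eval_sq_eq (x := 1 / 4)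
    (by norm_num [abs_of_pos]) (singularPart_mul_denom k)
  have h_pow (m : ℕ) : (1 / 4 : ℝ) ^ m = ((4 : ℝ) ^ m)⁻¹ := by rw [one_div, inv_pow]
  have h_deriv (m : ℕ) : (Polynomial.derivative (.X ^ m : Polynomial ℝ)).eval (1 / 4) =
      4 * m * (1 / 4) ^ m := by
    rw [Polynomial.derivative_X_pow]
    cases m <;> simp [pow_succ]
    ring
  simp only [denom, singularNum, Polynomial.derivative_add, Polynomial.derivative_sub,
    Polynomial.derivative_mul, Polynomial.derivative_C, Polynomial.derivative_X,
    Polynomial.derivative_one, h_deriv, Polynomial.eval_add, Polynomial.eval_sub,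
    Polynomial.eval_mul, Polynomial.eval_pow, Polynomial.eval_X, Polynomial.eval_one,
    Polynomial.eval_zero, Polynomial.eval_C] at h
  simp only [h_pow, pow_add, pow_mul'] at h
  have hx : (0 : ℝ) < 4 ^ k := by positivity
  rw [b, pow_mul', pow_add]
  generalize (4 : ℝ) ^ k = x at *
  push_cast at h ⊢
  rw [mul_div_assoc', eq_div_iff (by positivity)]
  field_simp at h
  refine mul_left_cancel₀ (by positivity : 8 * x + 1 ≠ 0) ?_
  linear_combination 2 * h

/-! ### Ratios of central binomial coefficients -/

theorem two_mul_four_pow_mul_centralBinom_le (i j : ℕ) :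
    2 * i * (4 ^ j * i.centralBinom) ≤ (2 * i + j) * (i + j).centralBinom := by
  induction j with
  | zero => simp
  | succ j ih =>
    have h_rec := Nat.succ_mul_centralBinom_succ (i + j)
    refine Nat.le_of_mul_le_mul_left ?_ (i + j).succ_pos
    calc (i + j + 1) * (2 * i * (4 ^ (j + 1) * i.centralBinom))
        = 4 * (i + j + 1) * (2 * i * (4 ^ j * i.centralBinom)) := by ring
      _ ≤ 4 * (i + j + 1) * ((2 * i + j) * (i + j).centralBinom) := by gcongr
      _ = 4 * (i + j + 1) * (2 * i + j) * (i + j).centralBinom := by ring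
      _ ≤ 2 * (2 * (i + j) + 1) * (2 * i + (j + 1)) * (i + j).centralBinom := by
        gcongr ?_ * _
        linarith
      _ = (2 * i + (j + 1)) * (2 * (2 * (i + j) + 1) * (i + j).centralBinom) := by ring
      _ = (i + j + 1) * ((2 * i + (j + 1)) * (i + (j + 1)).centralBinom) := by
        rw [← h_rec, ← add_assoc i j 1]
        ring

theorem mul_centralBinom_le_two_mul_four_pow (i j : ℕ) :
    (2 * (i + j + 1) + j) * (i + j).centralBinom ≤
      2 * (i + j + 1) * (4 ^ j * i.centralBinom) := by
  induction j with
  | zero => simp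
  | succ j ih =>
    have h_rec := Nat.succ_mul_centralBinom_succ (i + j)
    refine Nat.le_of_mul_le_mul_left ?_ (i + j).succ_pos
    calc (i + j + 1) * ((2 * (i + (j + 1) + 1) + (j + 1)) * (i + (j + 1)).centralBinom)
        = (2 * (i + j + 2) + (j + 1)) * (2 * (2 * (i + j) + 1) * (i + j).centralBinom) := by
          rw [← h_rec, ← add_assoc i j 1]
          ring
      _ = 2 * ((2 * (i + j + 2) + (j + 1)) * (2 * (i + j) + 1)) * (i + j).centralBinom := by ring
      _ ≤ 2 * (2 * (i + j + 2) * (2 * (i + j + 1) + j)) * (i + j).centralBinom := by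
        gcongr 2 * ?_ * _
        linarith
      _ = 4 * (i + j + 2) * ((2 * (i + j + 1) + j) * (i + j).centralBinom) := by ring
      _ ≤ 4 * (i + j + 2) * (2 * (i + j + 1) * (4 ^ j * i.centralBinom)) := by gcongr
      _ = (i + j + 1) * (2 * (i + (j + 1) + 1) * (4 ^ (j + 1) * i.centralBinom)) := by ring

/-- The coefficient of `X ^ m` in `(4 X) ^ j * centralSeries`, normalized to tend to `1` as `m`
tends to infinity. -/
noncomputable def centralRatio (m j : ℕ) : ℝ :=
  if j ≤ m then 4 ^ j * (m - j).centralBinom / m.centralBinom else 0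

theorem centralBinom_cast_pos (m : ℕ) : (0 : ℝ) < m.centralBinom :=
  Nat.cast_pos.2 m.centralBinom_pos

theorem one_add_le_centralRatio {m j : ℕ} (hj : j ≤ m) :
    1 + j / (2 * ((m : ℝ) + 1)) ≤ centralRatio m j := by
  obtain ⟨i, rfl⟩ := Nat.exists_eq_add_of_le' hj
  have h : ((2 * (i + j + 1) + j : ℕ) : ℝ) * (i + j).centralBinom ≤
      (2 * (i + j + 1) : ℕ) * (4 ^ j * i.centralBinom) := by
    exact_mod_cast mul_centralBinom_le_two_mul_four_pow i j
  push_cast at h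
  rw [centralRatio, if_pos hj, Nat.add_sub_cancel, one_add_div (by positivity),
    div_le_div_iff₀ (by positivity) (centralBinom_cast_pos _)]
  push_cast
  linarith

theorem centralRatio_le_one_add {m j : ℕ} (hj : j < m) :
    centralRatio m j ≤ 1 + j / (2 * ((m : ℝ) - j)) := by
  obtain ⟨i, rfl⟩ := Nat.exists_eq_add_of_le' hj.le
  have hi : 0 < i := by lia
  have h : ((2 * i : ℕ) : ℝ) * (4 ^ j * i.centralBinom) ≤
      (2 * i + j : ℕ) * (i + j).centralBinom := by
    exact_mod_cast two_mul_four_pow_mul_centralBinom_le i j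
  push_cast at h ⊢
  rw [centralRatio, if_pos hj.le, Nat.add_sub_cancel, add_sub_cancel_right,
    one_add_div (by positivity),
    div_le_div_iff₀ (centralBinom_cast_pos _) (by positivity)]
  linarith

theorem centralRatio_self_le (m : ℕ) : centralRatio m m ≤ 1 + 2 * m := by
  rw [centralRatio, if_pos le_rfl, Nat.sub_self, div_le_iff₀ (centralBinom_cast_pos m)]
  rcases m.eq_zero_or_pos with rfl | hm
  · simp
  · have h : (4 : ℝ) ^ m ≤ 2 * m * m.centralBinom := by
      exact_mod_cast Nat.four_pow_le_two_mul_self_mul_centralBinom m hm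
    have := centralBinom_cast_pos m
    rw [Nat.centralBinom_zero, Nat.cast_one]
    linarith

theorem centralRatio_le {m j : ℕ} (hj : j ≤ m) :
    centralRatio m j ≤ 1 + j / (2 * ((m : ℝ) + 1)) + 2 * ((j : ℝ) + 1) ^ 3 / ((m : ℝ) + 1) ^ 2 := by
  rcases hj.lt_or_eq with hj | rfl
  · have hi : (j : ℝ) + 1 ≤ m := by exact_mod_cast hj
    have hi_pos : 0 < (m : ℝ) - j := by linarith
    have h_inv : 1 / ((m : ℝ) - j) ≤ (j + 2) / (m + 1) := by
      rw [div_le_div_iff₀ hi_pos (by positivity)]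
      nlinarith [Nat.cast_nonneg (α := ℝ) j]
    calc centralRatio m j ≤ 1 + j / (2 * ((m : ℝ) - j)) := centralRatio_le_one_add hj
      _ = 1 + j / (2 * ((m : ℝ) + 1)) + j * (j + 1) / (2 * (m + 1)) * (1 / ((m : ℝ) - j)) := by
        field_simp
        ring
      _ ≤ 1 + j / (2 * ((m : ℝ) + 1)) + j * (j + 1) / (2 * (m + 1)) * ((j + 2) / (m + 1)) := by
        gcongr
      _ = 1 + j / (2 * ((m : ℝ) + 1)) + j * (j + 1) * (j + 2) / 2 / ((m : ℝ) + 1) ^ 2 := by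
        field_simp
      _ ≤ _ := by
        gcongr
        nlinarith [Nat.cast_nonneg (α := ℝ) j, sq_nonneg (j : ℝ)]
  · have h_cube : 2 * ((j : ℝ) + 1) ^ 3 / (j + 1) ^ 2 = 2 * (j + 1) := by field_simp
    have h_nonneg : 0 ≤ (j : ℝ) / (2 * (j + 1)) := by positivity
    linarith [centralRatio_self_le j]

theorem abs_centralRatio_sub_le (m j : ℕ) :
    |centralRatio m j - (1 + j / (2 * ((m : ℝ) + 1)))| ≤
      2 * ((j : ℝ) + 1) ^ 3 / ((m : ℝ) + 1) ^ 2 := by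
  rcases le_or_gt j m with hj | hj
  · rw [abs_of_nonneg (sub_nonneg.2 (one_add_le_centralRatio hj)), sub_le_iff_le_add']
    exact centralRatio_le hj
  · rw [centralRatio, if_neg hj.not_ge, zero_sub, abs_neg, abs_of_nonneg (by positivity),
      le_div_iff₀ (by positivity)]
    calc (1 + j / (2 * ((m : ℝ) + 1))) * (m + 1) ^ 2
        ≤ (1 + j / 1) * (j + 1) ^ 2 := by
          gcongr
          linarith
      _ ≤ 2 * ((j : ℝ) + 1) ^ 3 := by
          rw [div_one]
          nlinarith [pow_nonneg (by positivity : (0 : ℝ) ≤ j + 1) 3]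

/-! ### Transfer to coefficients -/

theorem exists_add_one_pow_mul_pow_le (p : ℕ) {x y : ℝ} (hx : 0 < x) (hxy : x < y) :
    ∃ K, ∀ j : ℕ, ((j : ℝ) + 1) ^ p * x ^ j ≤ K * y ^ j := by
  have hy : 0 < y := hx.trans hxy
  have h_lim := tendsto_pow_const_mul_const_pow_of_abs_lt_one p
    (by rwa [abs_of_pos (by positivity), div_lt_one hy] : |x / y| < 1)
  obtain ⟨K, hK⟩ := h_lim.bddAbove_range
  refine ⟨K * (y / x), fun j => ?_⟩
  calc ((j : ℝ) + 1) ^ p * x ^ j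
      = ((j + 1 : ℕ) : ℝ) ^ p * (x / y) ^ (j + 1) * (y / x) * y ^ j := by
        push_cast
        rw [div_pow, pow_succ, pow_succ]
        field_simp
    _ ≤ K * (y / x) * y ^ j := by
        gcongr
        exact hK ⟨j + 1, rfl⟩

theorem hasSum_coeff_mul_centralSeries_div (A : ℝ⟦X⟧) (m : ℕ) :
    HasSum (fun j => coeff j A * (1 / 4) ^ j * centralRatio m j)
      (coeff m (A * centralSeries) / m.centralBinom) := by
  have h_zero (j : ℕ) (hj : j ∉ Finset.range (m + 1)) :
      coeff j A * (1 / 4) ^ j * centralRatio m j = 0 := by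
    rw [centralRatio, if_neg (by simpa using hj), mul_zero]
  have h := hasSum_sum_of_ne_finset_zero (L := .unconditional ℕ) h_zero
  convert h using 1
  rw [coeff_mul, Finset.Nat.sum_antidiagonal_eq_sum_range_succ
    (fun i j => coeff i A * coeff j centralSeries), Finset.sum_div]
  refine Finset.sum_congr rfl fun j hj => ?_
  rw [centralRatio, if_pos (Finset.mem_range_succ_iff.1 hj), centralSeries, coeff_mk, one_div,
    inv_pow]
  field_simp

theorem inv_centralBinom_le (m : ℕ) :
    (m.centralBinom : ℝ)⁻¹ ≤ 2 * ((m : ℝ) + 1) * (1 / 4) ^ m := by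
  have h := centralRatio_self_le m
  rw [centralRatio, if_pos le_rfl, Nat.sub_self, Nat.centralBinom_zero, Nat.cast_one, mul_one,
    div_eq_mul_inv, ← le_div_iff₀' (by positivity), div_eq_mul_one_div, ← one_div_pow] at h
  refine h.trans ?_
  gcongr
  linarith

section Transfer

variable {ρ c K : ℝ} (hK : ∀ j : ℕ, ((j : ℝ) + 1) ^ 3 * (1 / 4) ^ j ≤ K * ρ ^ j)
include hK

theorem abs_mul_centralRatio_sub_le (x : ℝ) (m j : ℕ) :
    |x * (1 / 4) ^ j * centralRatio m j -
        (x * (1 / 4) ^ j + j * x * (1 / 4) ^ j / (2 * ((m : ℝ) + 1)))| ≤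
      2 * K / ((m : ℝ) + 1) ^ 2 * (|x| * ρ ^ j) :=
  calc |x * (1 / 4) ^ j * centralRatio m j -
          (x * (1 / 4) ^ j + j * x * (1 / 4) ^ j / (2 * ((m : ℝ) + 1)))|
      = |x| * (1 / 4) ^ j * |centralRatio m j - (1 + j / (2 * ((m : ℝ) + 1)))| := by
        rw [← abs_of_pos (by positivity : (0 : ℝ) < (1 / 4) ^ j), ← abs_mul, ← abs_mul,
          abs_of_pos (by positivity : (0 : ℝ) < (1 / 4) ^ j)]
        ring_nf
    _ ≤ |x| * (1 / 4) ^ j * (2 * ((j : ℝ) + 1) ^ 3 / ((m : ℝ) + 1) ^ 2) := by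
        gcongr
        exact abs_centralRatio_sub_le m j
    _ = 2 / ((m : ℝ) + 1) ^ 2 * (|x| * (((j : ℝ) + 1) ^ 3 * (1 / 4) ^ j)) := by ring
    _ ≤ 2 / ((m : ℝ) + 1) ^ 2 * (|x| * (K * ρ ^ j)) := by
        gcongr 2 / _ * (_ * ?_)
        exact hK j
    _ = 2 * K / ((m : ℝ) + 1) ^ 2 * (|x| * ρ ^ j) := by ring

theorem WeightedBound.abs_coeff_mul_centralSeries_sub_le {A : ℝ⟦X⟧} (hA : WeightedBound ρ A c)
    (hρ : 1 / 4 < ρ) (m : ℕ) :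
    |coeff m (A * centralSeries) / m.centralBinom -
        (evalAt (1 / 4) A + evalAt (1 / 4) (X * d⁄dX ℝ A) / (2 * (m + 1)))| ≤
      2 * K * c / ((m : ℝ) + 1) ^ 2 := by
  have hx : ‖(1 / 4 : ℝ)‖ < ρ := by rwa [Real.norm_of_nonneg (by norm_num)]
  have hρ' : 0 ≤ ρ := (norm_nonneg _).trans hx.le
  have hK_nonneg : 0 ≤ K := zero_le_one.trans (by simpa using hK 0)
  have h_value : HasSum _ (evalAt (1 / 4) A) :=
    (hA.summable_norm_coeff_mul_pow hx.le).of_norm.hasSum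
  have h_deriv : HasSum _ (evalAt (1 / 4) (X * d⁄dX ℝ A)) :=
    (hA.summable_norm_coeff_X_mul_derivative_mul_pow hx).of_norm.hasSum
  have h_diff := (hasSum_coeff_mul_centralSeries_div A m).sub
    (h_value.add (h_deriv.div_const (2 * ((m : ℝ) + 1))))
  have h_error := (hA.summable hρ').hasSum.mul_left (2 * K / ((m : ℝ) + 1) ^ 2)
  rw [← h_diff.tsum_eq, ← Real.norm_eq_abs]
  refine (tsum_of_norm_bounded h_error fun j => ?_).trans ?_
  · rw [coeff_X_mul_derivative]
    exact abs_mul_centralRatio_sub_le hK _ m j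
  · calc 2 * K / ((m : ℝ) + 1) ^ 2 * ∑' j, ‖coeff j A‖ * ρ ^ j
        ≤ 2 * K / ((m : ℝ) + 1) ^ 2 * c := by
          gcongr
          exact hA.tsum_le hρ'
      _ = 2 * K * c / ((m : ℝ) + 1) ^ 2 := by ring

theorem WeightedBound.abs_coeff_div_centralBinom_le {B : ℝ⟦X⟧} (hB : WeightedBound ρ B c)
    (hρ : 0 ≤ ρ) (m : ℕ) : |coeff m B / m.centralBinom| ≤ 2 * K * c / ((m : ℝ) + 1) ^ 2 := by
  have hK_nonneg : 0 ≤ K := zero_le_one.trans (by simpa using hK 0)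
  rw [abs_div, Nat.abs_cast, le_div_iff₀ (by positivity), div_eq_mul_inv]
  calc |coeff m B| * (m.centralBinom : ℝ)⁻¹ * ((m : ℝ) + 1) ^ 2
      ≤ |coeff m B| * (2 * (m + 1) * (1 / 4) ^ m) * ((m : ℝ) + 1) ^ 2 := by
        gcongr
        exact inv_centralBinom_le m
    _ = 2 * |coeff m B| * (((m : ℝ) + 1) ^ 3 * (1 / 4) ^ m) := by ring
    _ ≤ 2 * |coeff m B| * (K * ρ ^ m) := by
        gcongr 2 * _ * ?_
        exact hK m
    _ = 2 * K * (|coeff m B| * ρ ^ m) := by ring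
    _ ≤ 2 * K * c := by
        gcongr
        exact hB.norm_coeff_le hρ m

end Transfer

/-! ### The tail probabilities -/

theorem tailProb_zero (n : ℕ+) : tailProb n 0 = 1 := by
  simp [tailProb]

theorem tailProb_one {n : ℕ+} (hn : 2 ≤ n) : tailProb n 1 = 1 / 2 := by
  have hn' : 2 ≤ (n : ℕ) := by exact_mod_cast hn
  obtain ⟨m, hm⟩ := Nat.exists_eq_add_of_le' hn'
  have h := congrArg (coeff (m + 2)) two_mul_vertexSeries_one
  rw [show (2 : ℝ⟦X⟧) = C 2 from (map_ofNat C 2).symm, coeff_C_mul, coeff_succ_X_mul, map_sub,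
    coeff_one, if_neg m.succ_ne_zero, sub_zero, centralSeries, coeff_mk] at h
  rw [tailProb_eq, hm, Nat.add_sub_cancel_right (m + 1) 1,
    div_eq_div_iff (centralBinom_cast_pos _).ne' two_ne_zero]
  linarith

theorem exists_abs_tailProb_sub_le :
    ∃ K, 0 ≤ K ∧ ∀ n : ℕ+, 2 ≤ n → ∀ k : ℕ,
      |tailProb n k - (a k + b k * (1 / ((n : ℕ) : ℝ)))| ≤
        K * ((1 / 3) ^ k / ((n : ℕ) : ℝ) ^ 2) := by
  have hρ : (1 / 4 : ℝ) < 1 / 3 := by norm_num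
  obtain ⟨K, hK⟩ := exists_add_one_pow_mul_pow_le 3 (by norm_num) hρ
  have hK_nonneg : 0 ≤ K := zero_le_one.trans (by simpa using hK 0)
  refine ⟨288 * K, by positivity, fun n hn k => ?_⟩
  rcases k with _ | _ | k
  · rw [tailProb_zero]
    norm_num [a, b]
    positivity
  · rw [tailProb_one hn]
    norm_num [a, b]
    positivity
  · obtain ⟨m, hm⟩ : ∃ m, (n : ℕ) = m + 1 := Nat.exists_eq_add_of_le' n.pos
    have h_singular :=
      (weightedBound_singularPart k).abs_coeff_mul_centralSeries_sub_le hK hρ m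
    have h_regular :=
      (weightedBound_regularPart k).abs_coeff_div_centralBinom_le hK (by norm_num) m
    rw [evalAt_singularPart, evalAt_X_mul_derivative_singularPart, mul_div_mul_left _ _ two_ne_zero]
      at h_singular
    rw [tailProb_eq, hm, vertexSeries_add_two, coeff_succ_X_mul, Nat.add_sub_cancel, map_sub,
      sub_div, sub_right_comm, Nat.cast_succ, mul_one_div]
    refine (abs_sub _ _).trans ((add_le_add h_singular h_regular).trans_eq ?_)
    ring

/-! ### Convergence and numerical values of the constants -/

theorem add_one_sq_le_three_mul_two_pow (k : ℕ) : ((k : ℝ) + 1) ^ 2 ≤ 3 * 2 ^ k := by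
  have h_nat : (k + 1) ^ 2 ≤ 3 * 2 ^ k := by
    rcases k with _ | _ | k
    · norm_num
    · norm_num
    · induction k with
      | zero => norm_num
      | succ k ih =>
        have h_step : (k + 1 + 1 + 1 + 1) ^ 2 ≤ 2 * (k + 1 + 1 + 1) ^ 2 :=
          .intro (k := k ^ 2 + 4 * k + 2) (by ring)
        rw [pow_succ 2]
        linarith
  exact_mod_cast h_nat

theorem abs_mul_le_half_pow {k : ℕ} {w y : ℝ} (hw : |w| ≤ 2 * (k + 1))
    (hy : |y| ≤ 26 * (k + 1) / 4 ^ k) : |w * y| ≤ 156 * (1 / 2) ^ k :=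
  calc |w * y| ≤ 2 * (k + 1) * (26 * (k + 1) / 4 ^ k) := by
        rw [abs_mul]
        gcongr
    _ = 52 * (((k : ℝ) + 1) ^ 2 / 4 ^ k) := by ring
    _ ≤ 52 * (3 * 2 ^ k / 4 ^ k) := by
        gcongr
        exact add_one_sq_le_three_mul_two_pow k
    _ = 156 * (1 / 2) ^ k := by
        rw [mul_div_assoc, ← div_pow]
        norm_num [← mul_assoc]

theorem abs_a_le (k : ℕ) : |a k| ≤ 26 * (k + 1) / 4 ^ k := by
  rw [a, abs_of_pos (by positivity)]
  gcongr <;> linarith [k.cast_nonneg (α := ℝ)]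

theorem abs_b_le (k : ℕ) : |b k| ≤ 26 * (k + 1) / 4 ^ k := by
  have hx : (1 : ℝ) ≤ 4 ^ k := one_le_pow₀ (by norm_num)
  rw [b, pow_mul', abs_div, abs_of_pos (by positivity : (0 : ℝ) < 2 * (4 ^ k + 2) ^ 3)]
  generalize (4 : ℝ) ^ k = x at *
  have hx_sq : x ≤ x ^ 2 := le_self_pow₀ hx two_ne_zero
  have h_num : |(3 * (k : ℝ) - 10) * x ^ 2 + (6 * k + 26) * x - 16| ≤ 52 * (k + 1) * x ^ 2 := by
    have h_linear : (6 * (k : ℝ) + 26) * x ≤ (6 * k + 26) * x ^ 2 := by gcongr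
    have h_linear_nonneg : 0 ≤ (6 * (k : ℝ) + 26) * x := by positivity
    have h_quadratic : 0 ≤ (k : ℝ) * x ^ 2 := by positivity
    rw [abs_le]
    constructor <;> linarith
  calc |(3 * (k : ℝ) - 10) * x ^ 2 + (6 * k + 26) * x - 16| / (2 * (x + 2) ^ 3)
      ≤ 52 * (k + 1) * x ^ 2 / (2 * x ^ 3) := by
        gcongr
        linarith
    _ = 26 * (k + 1) / x := by
        field_simp
        norm_num

theorem abs_one_le (k : ℕ) : |(1 : ℝ)| ≤ 2 * (k + 1) := by
  rw [abs_one]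
  linarith [k.cast_nonneg (α := ℝ)]

theorem abs_two_mul_sub_one_le (k : ℕ) : |2 * (k : ℝ) - 1| ≤ 2 * (k + 1) := by
  rw [abs_le]
  constructor <;> linarith [k.cast_nonneg (α := ℝ)]

theorem abs_a_le_half_pow (k : ℕ) : |a k| ≤ 156 * (1 / 2) ^ k := by
  simpa only [one_mul] using abs_mul_le_half_pow (abs_one_le k) (abs_a_le k)

theorem abs_b_le_half_pow (k : ℕ) : |b k| ≤ 156 * (1 / 2) ^ k := by
  simpa only [one_mul] using abs_mul_le_half_pow (abs_one_le k) (abs_b_le k)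

theorem abs_two_mul_sub_one_mul_a_le_half_pow (k : ℕ) :
    |(2 * (k : ℝ) - 1) * a k| ≤ 156 * (1 / 2) ^ k :=
  abs_mul_le_half_pow (abs_two_mul_sub_one_le k) (abs_a_le k)

theorem abs_two_mul_sub_one_mul_b_le_half_pow (k : ℕ) :
    |(2 * (k : ℝ) - 1) * b k| ≤ 156 * (1 / 2) ^ k :=
  abs_mul_le_half_pow (abs_two_mul_sub_one_le k) (abs_b_le k)

theorem summable_of_abs_le_half_pow {f : ℕ → ℝ} {M : ℝ} (hf : ∀ k, |f k| ≤ M * (1 / 2) ^ k) :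
    Summable f :=
  .of_norm_bounded (summable_geometric_two.mul_left M) hf

theorem summable_pnat_of_abs_le_half_pow {f : ℕ → ℝ} {M : ℝ}
    (hf : ∀ k, |f k| ≤ M * (1 / 2) ^ k) : Summable fun k : ℕ+ => f k :=
  (summable_of_abs_le_half_pow hf).comp_injective PNat.coe_injective

/-- The sum of `q 1, …, q N` in units of `1 / S`, each term rounded down. Being an integer
computed from rational numbers, it can be evaluated by the kernel. -/
def roundedSum (S : ℕ) (q : ℕ → ℚ) (N : ℕ) : ℤ :=
  ∑ k ∈ Finset.range N, ⌊S * q (k + 1)⌋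

theorem abs_sum_sub_roundedSum_div_le {S : ℕ} (hS : 0 < S) (q : ℕ → ℚ) (N : ℕ) :
    |∑ k ∈ Finset.range N, (q (k + 1) : ℝ) - roundedSum S q N / S| ≤ N / S := by
  have hS' : (0 : ℝ) < S := Nat.cast_pos.2 hS
  have h_term (x : ℚ) : |(x : ℝ) - ⌊S * x⌋ / S| ≤ 1 / S := by
    have h_floor : |(S : ℝ) * x - ⌊S * x⌋| ≤ 1 := by
      rw [abs_of_nonneg (sub_nonneg.2 (mod_cast Int.floor_le (S * x))), sub_le_iff_le_add']
      exact_mod_cast (Int.lt_floor_add_one (S * x)).le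
    rw [le_div_iff₀ hS', ← abs_of_pos hS', ← abs_mul, abs_of_pos hS', sub_mul,
      div_mul_cancel₀ _ hS'.ne', mul_comm]
    exact h_floor
  rw [roundedSum, Int.cast_sum, Finset.sum_div, ← Finset.sum_sub_distrib]
  refine (Finset.abs_sum_le_sum_abs _ _).trans ((Finset.sum_le_sum fun k _ => h_term _).trans ?_)
  simp [div_eq_mul_inv]

theorem abs_tsum_add_le {f : ℕ → ℝ} {M : ℝ} (hf : ∀ k, |f k| ≤ M * (1 / 2) ^ k) (N : ℕ) :
    |∑' k, f (k + N + 1)| ≤ M * (1 / 2) ^ N := by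
  have h_geometric : HasSum (fun k : ℕ => M * (1 / 2) ^ (N + 1) * (1 / 2 : ℝ) ^ k)
      (M * (1 / 2) ^ (N + 1) * 2) := hasSum_geometric_two.mul_left _
  refine (tsum_of_norm_bounded (f := fun k => f (k + N + 1)) h_geometric fun k => ?_).trans_eq
    (by ring)
  exact (hf _).trans_eq (by ring)

theorem abs_tsum_sub_roundedSum_div_le {q : ℕ → ℚ} {M : ℝ}
    (hq : ∀ k, |(q k : ℝ)| ≤ M * (1 / 2) ^ k) {S : ℕ} (hS : 0 < S) (N : ℕ) :
    |∑' k : ℕ+, (q k : ℝ) - roundedSum S q N / S| ≤ N / S + M * (1 / 2) ^ N := by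
  have h_summable : Summable fun k => (q (k + 1) : ℝ) :=
    (summable_nat_add_iff 1).2 (summable_of_abs_le_half_pow hq)
  rw [tsum_pnat_eq_tsum_succ (f := fun k => (q k : ℝ)), ← h_summable.sum_add_tsum_nat_add N,
    add_sub_right_comm]
  exact (abs_add_le _ _).trans
    (add_le_add (abs_sum_sub_roundedSum_div_le hS q N) (abs_tsum_add_le hq N))

theorem abs_tsum_sub_le_of_roundedSum_eq {f : ℕ → ℝ} {q : ℕ → ℚ} (hfq : ∀ k, f k = q k)
    (hf : ∀ k, |f k| ≤ 156 * (1 / 2) ^ k) {z : ℤ} (hz : roundedSum (10 ^ 66) q 220 = z) :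
    |∑' k : ℕ+, f k - z / 10 ^ 66| ≤ 1 / 10 ^ 63 := by
  simp only [hfq] at hf ⊢
  have h := abs_tsum_sub_roundedSum_div_le hf (S := 10 ^ 66) (by positivity) 220
  rw [hz] at h
  simp only [Nat.cast_pow, Nat.cast_ofNat] at h
  exact h.trans (by norm_num)

/-- The rational number `a k`. -/
def aRat (k : ℕ) : ℚ := 3 / (4 ^ k + 2)

/-- The rational number `b k`. -/
def bRat (k : ℕ) : ℚ :=
  ((3 * k - 10) * 4 ^ (2 * k) + (6 * k + 26) * 4 ^ k - 16) / (2 * (4 ^ k + 2) ^ 3)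

theorem a_eq_aRat (k : ℕ) : a k = aRat k := by
  simp [a, aRat]

theorem b_eq_bRat (k : ℕ) : b k = bRat k := by
  simp [b, bRat]

theorem roundedSum_aRat : roundedSum (10 ^ 66) aRat 220 =
    727649276913726097531184400482145348863515722775042276537007958415 := by
  decide +kernel

theorem roundedSum_bRat : roundedSum (10 ^ 66) bRat 220 =
    -31183712598622277494524648993610043742589912871352172530717409107 := by
  decide +kernel

theorem roundedSum_two_mul_sub_one_mul_aRat :
    roundedSum (10 ^ 66) (fun k => (2 * k - 1) * aRat k) 220 =
      1346372849676697366285430870409451570812063606817172153259580066928 := by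
  decide +kernel

theorem roundedSum_two_mul_sub_one_mul_bRat :
    roundedSum (10 ^ 66) (fun k => (2 * k - 1) * bRat k) 220 =
      -53450918697323314110531205697658909427009721734610714508004063372 := by
  decide +kernel

theorem abs_d₀_sub_le :
    |d₀ - 727649276913726097531184400482145348863515722775042276537007958415 / 10 ^ 66| ≤
      1 / 10 ^ 63 := by
  simpa only [Int.cast_ofNat, d₀] using
    abs_tsum_sub_le_of_roundedSum_eq a_eq_aRat abs_a_le_half_pow roundedSum_aRat

theorem abs_d₁_sub_le :
    |d₁ - (-31183712598622277494524648993610043742589912871352172530717409107) / 10 ^ 66| ≤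
      1 / 10 ^ 63 := by
  simpa only [Int.cast_neg, Int.cast_ofNat, d₁] using
    abs_tsum_sub_le_of_roundedSum_eq b_eq_bRat abs_b_le_half_pow roundedSum_bRat

theorem abs_d₂_add_sq_sub_le :
    |d₂ + d₀ ^ 2 - 1346372849676697366285430870409451570812063606817172153259580066928 / 10 ^ 66| ≤
      1 / 10 ^ 63 := by
  rw [d₂, sub_add_cancel]
  simpa only [Int.cast_ofNat] using abs_tsum_sub_le_of_roundedSum_eq
    (f := fun k => (2 * (k : ℝ) - 1) * a k) (fun k => by rw [a_eq_aRat]; push_cast; rfl)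
    abs_two_mul_sub_one_mul_a_le_half_pow roundedSum_two_mul_sub_one_mul_aRat

theorem abs_d₃_add_mul_sub_le :
    |d₃ + 2 * d₀ * d₁ -
        (-53450918697323314110531205697658909427009721734610714508004063372) / 10 ^ 66| ≤
      1 / 10 ^ 63 := by
  rw [d₃, sub_add_cancel]
  simpa only [Int.cast_neg, Int.cast_ofNat] using abs_tsum_sub_le_of_roundedSum_eq
    (f := fun k => (2 * (k : ℝ) - 1) * b k) (fun k => by rw [b_eq_bRat]; push_cast; rfl)
    abs_two_mul_sub_one_mul_b_le_half_pow roundedSum_two_mul_sub_one_mul_bRat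

theorem abs_mul_sub_mul_le {x y u v ε : ℝ} (hx : |x - u| ≤ ε) (hy : |y - v| ≤ ε)
    (hu : |u| ≤ 1) (hv : |v| ≤ 1) (hε : ε ≤ 1) : |x * y - u * v| ≤ 3 * ε := by
  have hε_nonneg : 0 ≤ ε := (abs_nonneg _).trans hx
  calc |x * y - u * v| = |(x - u) * (y - v) + u * (y - v) + (x - u) * v| := by ring_nf
    _ ≤ |x - u| * |y - v| + |u| * |y - v| + |x - u| * |v| := by
        simpa only [abs_mul] using abs_add_three ((x - u) * (y - v)) (u * (y - v)) ((x - u) * v)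
    _ ≤ ε * 1 + 1 * ε + ε * 1 := by
        gcongr
        exact hy.trans hε
    _ = 3 * ε := by ring

theorem abs_d₀_sub_lt :
    |d₀ - 0.727649276913726097531184400482145348863515722775042276537008| < 1 / 10 ^ 60 := by
  have h := abs_le.1 abs_d₀_sub_le
  rw [abs_lt]
  norm_num only at *
  constructor <;> linarith [h.1, h.2]

theorem abs_d₁_sub_lt :
    |d₁ - (-0.0311837125986222774945246489936100437425899128713521725307175)| < 1 / 10 ^ 61 := by
  have h := abs_le.1 abs_d₁_sub_le
  rw [abs_lt]
  norm_num only at *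
  constructor <;> linarith [h.1, h.2]

theorem abs_d₂_sub_lt :
    |d₂ - 0.81689937948362892278879205623322983539562628691031631640757| < 1 / 10 ^ 59 := by
  have h := abs_le.1 abs_d₂_add_sq_sub_le
  have h_sq := abs_le.1 (abs_mul_sub_mul_le abs_d₀_sub_le abs_d₀_sub_le
    (by rw [abs_le]; norm_num) (by rw [abs_le]; norm_num) (by norm_num))
  rw [← sq] at h_sq
  rw [abs_lt]
  norm_num only at *
  constructor <;> linarith [h.1, h.2, h_sq.1, h_sq.2]

theorem abs_d₃_sub_lt :
    |d₃ - (-0.008069306849577412439260970341290668150739539610413792698447)| < 1 / 10 ^ 60 := by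
  have h := abs_le.1 abs_d₃_add_mul_sub_le
  have h_mul := abs_le.1 (abs_mul_sub_mul_le abs_d₀_sub_le abs_d₁_sub_le
    (by rw [abs_le]; norm_num) (by rw [abs_le]; norm_num) (by norm_num))
  rw [mul_assoc] at h
  rw [abs_lt]
  norm_num only at *
  constructor <;> linarith [h.1, h.2, h_mul.1, h_mul.2]

/-! ### The limit law -/

theorem limitProb_eq_sub (k : ℕ) : limitProb k = a k - a (k + 1) := by
  rw [limitProb, a, a, pow_succ]
  field_simp
  ring

theorem correctionProb_eq_sub (k : ℕ) : correctionProb k = b k - b (k + 1) := by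
  simp only [correctionProb, b, pow_mul', pow_succ (4 : ℝ) k]
  have hx : (0 : ℝ) < 4 ^ k := by positivity
  generalize (4 : ℝ) ^ k = x at *
  rw [div_sub_div _ _ (by positivity) (by positivity), div_eq_div_iff (by positivity)
    (by positivity)]
  push_cast
  ring

theorem limitProb_nonneg (k : ℕ) : 0 ≤ limitProb k := by
  unfold limitProb
  positivity

theorem hasSum_limitProb : HasSum limitProb 1 := by
  rw [hasSum_iff_tendsto_nat_of_nonneg limitProb_nonneg]
  have h_partial (N : ℕ) : ∑ k ∈ Finset.range N, limitProb k = 1 - a N := by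
    simp only [limitProb_eq_sub, Finset.sum_range_sub']
    norm_num [a]
  have h_lim := (summable_of_abs_le_half_pow abs_a_le_half_pow).tendsto_atTop_zero.const_sub 1
  simpa only [h_partial, sub_zero] using h_lim

theorem exists_abs_prob_sub_le :
    ∃ C, ∀ n : ℕ+, 2 ≤ n → ∀ k : ℕ,
      |(P n).real {ω | Y n ω = k} - (limitProb k + correctionProb k * (1 / ((n : ℕ) : ℝ)))| ≤
        C * ((k : ℝ) ^ 2 / (3 ^ k * ((n : ℕ) : ℝ) ^ 2)) := by
  obtain ⟨K, hK_nonneg, hK⟩ := exists_abs_tailProb_sub_le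
  refine ⟨2 * K, fun n hn k => ?_⟩
  rw [prob_eq_sub_tailProb, limitProb_eq_sub, correctionProb_eq_sub]
  rcases k.eq_zero_or_pos with rfl | hk
  · rw [tailProb_zero, zero_add, tailProb_one hn]
    norm_num [a, b]
  · have hk_sq : (1 : ℝ) ≤ (k : ℝ) ^ 2 := one_le_pow₀ (by exact_mod_cast hk)
    have h_succ : K * ((1 / 3) ^ (k + 1) / ((n : ℕ) : ℝ) ^ 2) ≤
        K * ((1 / 3) ^ k / ((n : ℕ) : ℝ) ^ 2) := by
      gcongr _ * (?_ / _)
      exact pow_le_pow_of_le_one (by norm_num) (by norm_num) k.le_succ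
    calc |tailProb n k - tailProb n (k + 1) -
            (a k - a (k + 1) + (b k - b (k + 1)) * (1 / ((n : ℕ) : ℝ)))|
        = |tailProb n k - (a k + b k * (1 / ((n : ℕ) : ℝ))) -
            (tailProb n (k + 1) - (a (k + 1) + b (k + 1) * (1 / ((n : ℕ) : ℝ))))| := by
          ring_nf
      _ ≤ K * ((1 / 3) ^ k / ((n : ℕ) : ℝ) ^ 2) + K * ((1 / 3) ^ k / ((n : ℕ) : ℝ) ^ 2) :=
          (abs_sub _ _).trans (add_le_add (hK n hn k) ((hK n hn (k + 1)).trans h_succ))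
      _ = 2 * K * (1 / (3 ^ k * ((n : ℕ) : ℝ) ^ 2)) := by
          rw [one_div_pow, div_div]
          ring
      _ ≤ 2 * K * ((k : ℝ) ^ 2 / (3 ^ k * ((n : ℕ) : ℝ) ^ 2)) := by gcongr

theorem tendsto_one_div_size : Tendsto (fun n : ℕ+ => 1 / ((n : ℕ) : ℝ)) atTop (𝓝 0) :=
  tendsto_one_div_atTop_nhds_zero_nat.comp tendsto_PNat_val_atTop_atTop

theorem tendsto_prob (k : ℕ) :
    Tendsto (fun n : ℕ+ => (P n).real {ω | Y n ω = k}) atTop (𝓝 (limitProb k)) := by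
  obtain ⟨C, hC⟩ := exists_abs_prob_sub_le
  have h_main : Tendsto (fun n : ℕ+ => limitProb k + correctionProb k * (1 / ((n : ℕ) : ℝ)))
      atTop (𝓝 (limitProb k)) := by
    simpa using (tendsto_one_div_size.const_mul (correctionProb k)).const_add (limitProb k)
  have h_bound : Tendsto (fun n : ℕ+ => C * ((k : ℝ) ^ 2 / 3 ^ k) * (1 / ((n : ℕ) : ℝ)) ^ 2) atTop
      (𝓝 0) := by
    simpa using (tendsto_one_div_size.pow 2).const_mul (C * ((k : ℝ) ^ 2 / 3 ^ k))
  have h_error : Tendsto (fun n : ℕ+ => (P n).real {ω | Y n ω = k} -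
      (limitProb k + correctionProb k * (1 / ((n : ℕ) : ℝ)))) atTop (𝓝 0) :=
    squeeze_zero_norm'
      ((eventually_ge_atTop 2).mono fun n hn => (hC n hn k).trans_eq (by ring)) h_bound
  simpa using h_error.add h_main

/-! ### Expectation and variance -/

theorem isBigO_sub_of_hasSum_mul_tailProb {w : ℕ → ℝ} (hw : ∀ k, |w k| ≤ 2 * (k + 1))
    {E : ℕ+ → ℝ} (hE : ∀ n, HasSum (fun k : ℕ+ => w k * tailProb n k) (E n)) :
    (fun n : ℕ+ => E n - ((∑' k : ℕ+, w k * a k) + (∑' k : ℕ+, w k * b k) * (1 / ((n : ℕ) : ℝ))))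
      =O[atTop] fun n : ℕ+ => (1 / ((n : ℕ) : ℝ)) ^ 2 := by
  obtain ⟨K, hK_nonneg, hK⟩ := exists_abs_tailProb_sub_le
  obtain ⟨L, hL⟩ :=
    exists_add_one_pow_mul_pow_le 1 (by norm_num) (by norm_num : (1 / 3 : ℝ) < 1 / 2)
  have h_term {n : ℕ+} (hn : 2 ≤ n) (k : ℕ) :
      ‖w k * tailProb n k - (w k * a k + w k * b k * (1 / ((n : ℕ) : ℝ)))‖ ≤
        2 * K * L * (1 / ((n : ℕ) : ℝ)) ^ 2 * (1 / 2) ^ k :=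
    calc ‖w k * tailProb n k - (w k * a k + w k * b k * (1 / ((n : ℕ) : ℝ)))‖
        = |w k| * |tailProb n k - (a k + b k * (1 / ((n : ℕ) : ℝ)))| := by
          rw [Real.norm_eq_abs, ← abs_mul]
          ring_nf
      _ ≤ 2 * ((k : ℝ) + 1) * (K * ((1 / 3) ^ k / ((n : ℕ) : ℝ) ^ 2)) := by
          gcongr
          · exact hw k
          · exact hK n hn k
      _ = 2 * K * (1 / ((n : ℕ) : ℝ)) ^ 2 * (((k : ℝ) + 1) ^ 1 * (1 / 3) ^ k) := by ring
      _ ≤ 2 * K * (1 / ((n : ℕ) : ℝ)) ^ 2 * (L * (1 / 2) ^ k) := by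
          gcongr _ * ?_
          exact hL k
      _ = 2 * K * L * (1 / ((n : ℕ) : ℝ)) ^ 2 * (1 / 2) ^ k := by ring
  have h_summable {f : ℕ → ℝ} (hf : ∀ k, |f k| ≤ 26 * (k + 1) / 4 ^ k) :
      Summable fun k : ℕ+ => w k * f k :=
    summable_pnat_of_abs_le_half_pow fun k => abs_mul_le_half_pow (hw k) (hf k)
  have h_geometric : Summable fun k : ℕ+ => (1 / 2 : ℝ) ^ (k : ℕ) :=
    summable_geometric_two.comp_injective PNat.coe_injective
  refine .of_bound (2 * K * L * ∑' k : ℕ+, (1 / 2 : ℝ) ^ (k : ℕ))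
    ((eventually_ge_atTop 2).mono fun n hn => ?_)
  have h_diff := (hE n).sub ((h_summable abs_a_le).hasSum.add
    ((h_summable abs_b_le).hasSum.mul_right (1 / ((n : ℕ) : ℝ))))
  rw [← h_diff.tsum_eq, Real.norm_of_nonneg (by positivity : 0 ≤ (1 / ((n : ℕ) : ℝ)) ^ 2)]
  exact (tsum_of_norm_bounded (h_geometric.hasSum.mul_left _) fun k => h_term hn k).trans_eq
    (by ring)

theorem isBigO_sq_sub {α : Type*} {l : Filter α} {f u : α → ℝ} {x y : ℝ}
    (hu : Tendsto u l (𝓝 0)) (hf : (fun i => f i - (x + y * u i)) =O[l] fun i => u i ^ 2) :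
    (fun i => f i ^ 2 - (x ^ 2 + 2 * x * y * u i)) =O[l] fun i => u i ^ 2 := by
  have h_main : Tendsto (fun i => x + y * u i) l (𝓝 x) := by
    simpa using (hu.const_mul y).const_add x
  have h_error : Tendsto (fun i => f i - (x + y * u i)) l (𝓝 0) :=
    hf.trans_tendsto (by simpa using hu.pow 2)
  have h_sum : (fun i => f i + (x + y * u i)) =O[l] fun _ => (1 : ℝ) :=
    ((h_error.add (h_main.const_mul 2)).congr fun i => by ring).isBigO_one ℝ
  have h_cross : (fun i => (f i - (x + y * u i)) * (f i + (x + y * u i))) =O[l]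
      fun i => u i ^ 2 := by
    simpa only [mul_one] using hf.mul h_sum
  exact (h_cross.add ((isBigO_refl _ l).const_mul_left (y ^ 2))).congr_left fun i => by ring

theorem isBigO_one_div_sq_one_div_rpow :
    (fun n : ℕ+ => (1 / ((n : ℕ) : ℝ)) ^ 2) =O[atTop]
      fun n : ℕ+ => 1 / ((n : ℕ) : ℝ) ^ (3 / 2 : ℝ) := by
  refine .of_norm_le fun n => ?_
  rw [one_div_pow, ← Real.rpow_natCast, Real.norm_of_nonneg (by positivity)]
  gcongr
  · exact_mod_cast n.pos
  · norm_num

theorem isBigO_integral_Y_sub :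
    (fun n : ℕ+ => (∫ ω, (Y n ω : ℝ) ∂(P n)) - (d₀ + d₁ * (1 / ((n : ℕ) : ℝ))))
      =O[atTop] fun n : ℕ+ => (1 / ((n : ℕ) : ℝ)) ^ 2 := by
  simpa only [one_mul, d₀, d₁] using isBigO_sub_of_hasSum_mul_tailProb abs_one_le fun n => by
    simpa only [one_mul] using hasSum_tailProb n

theorem isBigO_variance_Y_sub :
    (fun n : ℕ+ => variance (fun ω => (Y n ω : ℝ)) (P n) - (d₂ + d₃ * (1 / ((n : ℕ) : ℝ))))
      =O[atTop] fun n : ℕ+ => (1 / ((n : ℕ) : ℝ)) ^ 2 := by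
  have h_second := isBigO_sub_of_hasSum_mul_tailProb abs_two_mul_sub_one_le
    hasSum_two_mul_sub_one_mul_tailProb
  have h_first_sq := isBigO_sq_sub tendsto_one_div_size isBigO_integral_Y_sub
  refine (h_second.sub h_first_sq).congr_left fun n => ?_
  rw [variance_Y, d₂, d₃]
  ring

end PlaneTree

theorem theorem2 :
    -- the law of `Y n` tends to a discrete limit distribution
    ((∀ k, 0 ≤ PlaneTree.limitProb k) ∧ HasSum PlaneTree.limitProb 1 ∧
      ∀ k : ℕ, Tendsto (fun n : ℕ+ => (PlaneTree.P n).real {ω | PlaneTree.Y n ω = k}) atTop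
        (𝓝 (PlaneTree.limitProb k))) ∧
    -- the expansion of the probabilities, uniformly in `k`
    (∃ (C : ℝ) (N : ℕ+), ∀ n : ℕ+, N ≤ n → ∀ k : ℕ,
      |(PlaneTree.P n).real {ω | PlaneTree.Y n ω = k}
          - (PlaneTree.limitProb k + PlaneTree.correctionProb k * (1 / ((n : ℕ) : ℝ)))|
        ≤ C * ((k : ℝ) ^ 2 / (3 ^ k * ((n : ℕ) : ℝ) ^ 2))) ∧
    -- the series that define the constants converge, and the values of the constants
    (Summable (fun k : ℕ+ => PlaneTree.a k) ∧ Summable (fun k : ℕ+ => PlaneTree.b k) ∧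
      Summable (fun k : ℕ+ => (2 * (k : ℝ) - 1) * PlaneTree.a k) ∧
      Summable (fun k : ℕ+ => (2 * (k : ℝ) - 1) * PlaneTree.b k)) ∧
    (|PlaneTree.d₀ - 0.727649276913726097531184400482145348863515722775042276537008|
        < 1 / 10 ^ 60 ∧
      |PlaneTree.d₁ - (-0.0311837125986222774945246489936100437425899128713521725307175)|
        < 1 / 10 ^ 61 ∧
      |PlaneTree.d₂ - 0.81689937948362892278879205623322983539562628691031631640757|
        < 1 / 10 ^ 59 ∧
      |PlaneTree.d₃ - (-0.008069306849577412439260970341290668150739539610413792698447)|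
        < 1 / 10 ^ 60) ∧
    -- the expectation and the variance
    ((fun n : ℕ+ => (∫ ω, (PlaneTree.Y n ω : ℝ) ∂(PlaneTree.P n))
          - (PlaneTree.d₀ + PlaneTree.d₁ * (1 / ((n : ℕ) : ℝ))))
        =O[atTop] fun n : ℕ+ => 1 / ((n : ℕ) : ℝ) ^ (3 / 2 : ℝ)) ∧
    ((fun n : ℕ+ => variance (fun ω => (PlaneTree.Y n ω : ℝ)) (PlaneTree.P n)
          - (PlaneTree.d₂ + PlaneTree.d₃ * (1 / ((n : ℕ) : ℝ))))
        =O[atTop] fun n : ℕ+ => 1 / ((n : ℕ) : ℝ) ^ (3 / 2 : ℝ)) := by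
  open PlaneTree in
  obtain ⟨C, hC⟩ := exists_abs_prob_sub_le
  exact ⟨⟨limitProb_nonneg, hasSum_limitProb, tendsto_prob⟩, ⟨C, 2, hC⟩,
    ⟨summable_pnat_of_abs_le_half_pow abs_a_le_half_pow,
      summable_pnat_of_abs_le_half_pow abs_b_le_half_pow,
      summable_pnat_of_abs_le_half_pow abs_two_mul_sub_one_mul_a_le_half_pow,
      summable_pnat_of_abs_le_half_pow abs_two_mul_sub_one_mul_b_le_half_pow⟩,
    ⟨abs_d₀_sub_lt, abs_d₁_sub_lt, abs_d₂_sub_lt, abs_d₃_sub_lt⟩,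
    isBigO_integral_Y_sub.trans isBigO_one_div_sq_one_div_rpow,
    isBigO_variance_Y_sub.trans isBigO_one_div_sq_one_div_rpow⟩
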